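/- Let $n\ge 0$ and let $X$ and $Y$ be smooth projective schemes over $\mathbb{C}$, purely of dimension $n$ (not necessarily irreducible). Assume that their canonical line bundles are trivial, i.e. $\Omega^n_{X/\mathbb{C}}\cong\mathcal{O}_X$ and $\Omega^n_{Y/\mathbb{C}}\cong\mathcal{O}_Y$ as sheaves of modules, and that $X$ and $Y$ are birational over $\mathbb{C}$, i.e. some dense Zariski open subset of $X$ is isomorphic over $\mathbb{C}$ to some dense Zariski open subset of $Y$. Then there exist dense Zariski open subsets $U\subset X$ and $V\subset Y$ such that $U$ and $V$ are isomorphic over $\mathbb{C}$ and $$\operatorname{codim}_X(X\setminus U)\ge 2,\qquad \operatorname{codim}_Y(Y\setminus V)\ge 2,$$ where the empty set has codimension $\infty$. -/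

import Mathlib

open CategoryTheory AlgebraicGeometry TopologicalSpace

noncomputable section

universe u v

/-! ### Exterior powers of presheaves of modules -/

/-- The `n`-alternating map `(m₁, …, mₙ) ↦ g m₁ ∧ ⋯ ∧ g mₙ` attached to a semilinear map `g`. -/
def wedgeRestrict {R S : Type u} [CommRing R] [CommRing S] (σ : R →+* S)
    {M : ModuleCat.{u} R} {N : ModuleCat.{u} S} (g : M ⟶ (ModuleCat.restrictScalars σ).obj N)
    (n : ℕ) : M.AlternatingMap ((ModuleCat.restrictScalars σ).obj (N.exteriorPower n)) n :=
  letI g' : M → N := fun m => g m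
  haveI hadd : ∀ x y, g' (x + y) = g' x + g' y := fun x y => map_add g.hom x y
  haveI hsmul : ∀ (c : R) x, g' (c • x) = σ c • g' x := fun c x => map_smul g.hom c x
  haveI hupd : ∀ [DecidableEq (Fin n)] (m : Fin n → M) (i : Fin n) (x : M),
      (fun j => g' (Function.update m i x j)) = Function.update (fun j => g' (m j)) i (g' x) := by
    intro _ m i x
    funext j
    by_cases h : j = i
    · subst h; simp
    · simp [h]
  { toFun := fun m => (exteriorPower.ιMulti S n (fun i => g' (m i)) : ⋀[S]^n N)
    map_update_add' := fun m i x y => by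
      rw [hupd, hupd, hupd, hadd]
      exact (exteriorPower.ιMulti S n).map_update_add _ i _ _
    map_update_smul' := fun m i c x => by
      rw [hupd, hupd, hsmul]
      exact (exteriorPower.ιMulti S n).map_update_smul _ i _ _
    map_eq_zero_of_eq' := fun m i j h hij =>
      (exteriorPower.ιMulti S n).map_eq_zero_of_eq _ (congrArg g' h) hij }

/-- The map `⋀^n M → ⋀^n N` (over a ring homomorphism `σ : R → S`) induced by a `σ`-semilinear
map `g : M → N`: it sends `m₁ ∧ ⋯ ∧ mₙ` to `g m₁ ∧ ⋯ ∧ g mₙ`. -/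
def exteriorPowerMapRestrict {R S : Type u} [CommRing R] [CommRing S] (σ : R →+* S)
    {M : ModuleCat.{u} R} {N : ModuleCat.{u} S} (g : M ⟶ (ModuleCat.restrictScalars σ).obj N)
    (n : ℕ) :
    M.exteriorPower n ⟶ (ModuleCat.restrictScalars σ).obj (N.exteriorPower n) :=
  ModuleCat.exteriorPower.desc (wedgeRestrict σ g n)

theorem exteriorPowerMapRestrict_mk {R S : Type u} [CommRing R] [CommRing S] (σ : R →+* S)
    {M : ModuleCat.{u} R} {N : ModuleCat.{u} S} (g : M ⟶ (ModuleCat.restrictScalars σ).obj N)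
    (n : ℕ) (m : Fin n → M) :
    exteriorPowerMapRestrict σ g n (ModuleCat.exteriorPower.mk m) =
      (ModuleCat.exteriorPower.mk (M := N) (n := n) (fun i => g (m i)) :) :=
  ModuleCat.exteriorPower.desc_mk _ m

/-- The presheaf of modules `U ↦ ⋀^n M(U)`, the exterior powers being taken over `R(U)`. -/
def PresheafOfModules.exteriorPower {C : Type*} [Category* C] {R : Cᵒᵖ ⥤ CommRingCat.{u}}
    (M : PresheafOfModules.{u} (R ⋙ forget₂ CommRingCat RingCat)) (n : ℕ) :
    PresheafOfModules.{u} (R ⋙ forget₂ CommRingCat RingCat) where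
  obj U := ModuleCat.exteriorPower (R := R.obj U) (M.obj U) n
  map {U V} f := exteriorPowerMapRestrict (R.map f).hom (M.map f) n
  map_id U := by
    refine ModuleCat.exteriorPower.hom_ext (R := R.obj U) (M := M.obj U) ?_
    refine ModuleCat.AlternatingMap.ext fun x => ?_
    refine (exteriorPowerMapRestrict_mk (R.map (𝟙 U)).hom (M.map (𝟙 U)) n x).trans ?_
    refine congrArg (ModuleCat.exteriorPower.mk (R := R.obj U) (M := M.obj U) (n := n)) ?_
    funext i
    exact congrArg (fun φ => φ.hom (x i)) (M.map_id U)
  map_comp {U V W} f g := by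
    refine ModuleCat.exteriorPower.hom_ext (R := R.obj U) (M := M.obj U) ?_
    refine ModuleCat.AlternatingMap.ext fun x => ?_
    refine (exteriorPowerMapRestrict_mk (R.map (f ≫ g)).hom (M.map (f ≫ g)) n x).trans ?_
    refine Eq.trans ?_ (congrArg (exteriorPowerMapRestrict (R.map g).hom (M.map g) n)
      (exteriorPowerMapRestrict_mk (R.map f).hom (M.map f) n x)).symm
    refine Eq.trans ?_ (exteriorPowerMapRestrict_mk (R.map g).hom (M.map g) n _).symm
    refine congrArg (ModuleCat.exteriorPower.mk (R := R.obj W) (M := M.obj W) (n := n)) ?_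
    funext i
    exact M.map_comp_apply f g (x i)

namespace AlgebraicGeometry.Scheme

/-! ### The canonical sheaf -/

/-- For a scheme `X` over `Spec k`, the `k`-algebra structures `k ⟶ Γ(X, U)`. -/
def structureHom {k : CommRingCat.{u}} {X : Scheme.{u}} (f : X ⟶ Spec k) :
    (Functor.const X.Opensᵒᵖ).obj k ⟶ X.presheaf where
  app U := (ΓSpecIso k).inv ≫ f.appTop ≫ X.presheaf.map (homOfLE le_top).op
  naturality U V i := by
    simp [← Functor.map_comp]
    rfl

/-- The sheaf of relative differential `n`-forms `Ω^n_{X/k}` of a scheme `f : X ⟶ Spec k`: the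
sheaf of modules associated with the presheaf `U ↦ ⋀^n Ω_{Γ(X, U)/k}`. -/
def differentialForms {k : CommRingCat.{u}} {X : Scheme.{u}} (f : X ⟶ Spec k) (n : ℕ) :
    X.Modules :=
  (PresheafOfModules.sheafification (𝟙 X.ringCatSheaf.obj)).obj
    ((PresheafOfModules.DifferentialsConstruction.relativeDifferentials'
      (structureHom f)).exteriorPower n)

/-- The structure sheaf of `X` as a module over itself. -/
def structureModule (X : Scheme.{u}) : X.Modules := SheafOfModules.unit X.ringCatSheaf

/-- For `f : X ⟶ Spec k` smooth of relative dimension `n`, the canonical line bundle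
`Ω^n_{X/k}` is trivial, i.e. isomorphic to `𝒪_X` as an `𝒪_X`-module. -/
def HasTrivialCanonicalBundle {k : CommRingCat.{u}} {X : Scheme.{u}} (f : X ⟶ Spec k) (n : ℕ) :
    Prop :=
  Nonempty (differentialForms f n ≅ structureModule X)

/-! ### Projective schemes -/

attribute [local instance] MvPolynomial.gradedAlgebra

/-- The standard grading of `k[x₀, …, x_N]`. -/
abbrev projectiveGrading (k : Type u) [CommRing k] (N : ℕ) :
    ℕ → Submodule k (MvPolynomial (Fin (N + 1)) k) :=
  MvPolynomial.homogeneousSubmodule (Fin (N + 1)) k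

/-- The projective space `ℙ^N_k = Proj k[x₀, …, x_N]`. -/
def projectiveSpace (k : Type u) [CommRing k] (N : ℕ) : Scheme.{u} :=
  Proj (projectiveGrading k N)

/-- The structure morphism `ℙ^N_k ⟶ Spec k`. -/
def projectiveSpaceToSpec (k : Type u) [CommRing k] (N : ℕ) :
    projectiveSpace k N ⟶ Spec (CommRingCat.of k) :=
  Proj.toSpecZero (projectiveGrading k N) ≫
    Spec.map (CommRingCat.ofHom (algebraMap k (projectiveGrading k N 0)))

/-- `f : X ⟶ Spec k` is projective: `X` is isomorphic over `k` to a closed subscheme of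
some projective space `ℙ^N_k`. -/
def IsProjectiveOver {k : Type u} [CommRing k] {X : Scheme.{u}}
    (f : X ⟶ Spec (CommRingCat.of k)) : Prop :=
  ∃ (N : ℕ) (i : X ⟶ projectiveSpace k N),
    IsClosedImmersion i ∧ i ≫ projectiveSpaceToSpec k N = f

/-! ### Codimension -/

/-- The codimension in `X` of a closed subset `Z`: the infimum of the codimensions of its points,
where the codimension of a point `z` is the supremum of the lengths `r` of chains
`closure {z} = Z₀ ⊂ Z₁ ⊂ ⋯ ⊂ Z_r` of irreducible closed subsets of `X`, equivalently the
dimension of the local ring at `z`. The codimension of the empty set is `∞`. -/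
def codim {X : Scheme.{u}} (Z : Set X) : ℕ∞ :=
  ⨅ z ∈ Z, Order.coheight z

end AlgebraicGeometry.Scheme

end

/-!
A birational map between smooth proper schemes with trivial canonical bundles is an isomorphism in
codimension one. The trivializations are viewed as volume forms `ωX` and `ωY`, given by their germs
in the modules of `n`-forms of the local rings (`VolumeForm`). On smooth schemes, the points of
codimension at most one are handled as the points whose local ring is a principal ideal ring.

Let `f` be the extension of the birational map `X ⇢ Y` to its maximal domain. By the valuative
criterion, `f` is defined at all points of codimension at most one
(`mem_domain_toRationalMap_of_isPrincipalIdealRing`). So `f^* ωY = c • ωX` for a rational function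
`c` on `X` which is regular in codimension one. As `f` is birational, `c` is nonzero on each
component. By Hartogs, `c` is a global section on each component of `X`; the component is integral
and proper, so its global sections form a field and `c` is a unit
(`exists_isUnit_stalkSpecializes_eq`).

Hence at a point `x` where `f` is defined the map `𝒪_{Y, f x} → 𝒪_{X, x}` carries a generator of
the top forms to a generator, and thus a basis of the differentials to a basis. If the maximal ideal
of `𝒪_{X, x}` is principal, this forces that of `𝒪_{Y, f x}` to be principal
(`IsLocalRing.isPrincipal_maximalIdeal_of_basis_kaehlerDifferential`): two elements of the latter
have differentials whose values at the closed point are proportional, and an element whose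
differential vanishes at the closed point lies in the square of the maximal ideal, as `Y` is smooth
over a perfect field. So `f` maps points of codimension at most one to such points
(`isPrincipalIdealRing_stalk_of_volumeForm`).

The same holds for the extension `g` of the inverse map. Therefore the open subset `U` of points
`x` where `f` is defined and `g` is defined at `f x` contains all points of codimension at most one.
The maps `f` and `g` restrict to inverse isomorphisms between `U` and the analogous open subset of
`Y` (`PartialMap.exists_iso_domainComp`).
-/

universe u

open scoped TensorProduct

/-! ### Local rings of smooth algebras are integrally closed domains -/

/-- A local ring that is integrally closed in a product of fields is an integrally closed
domain: the idempotents of the product are integral, so lie in the local ring, and hence the product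
has a single factor. -/
theorem isDomain_and_isIntegrallyClosed_of_ringEquiv_pi {A L ι : Type*} [CommRing A] [IsLocalRing A]
    [CommRing L] [Algebra A L] [IsIntegrallyClosedIn A L] {F : ι → Type*} [∀ i, Field (F i)]
    (e : L ≃+* Π i, F i) : IsDomain A ∧ IsIntegrallyClosed A := by
  classical
  have hinj : Function.Injective (algebraMap A L) :=
    IsIntegralClosure.algebraMap_injective A A L
  have : Nontrivial L := hinj.nontrivial
  have idem : ∀ x : L, x * x = x → x = 0 ∨ x = 1 := by
    intro x hx
    have hint : IsIntegral A x := ⟨Polynomial.X ^ 2 - Polynomial.X, by monicity!, by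
      simp [pow_two, hx]⟩
    obtain ⟨a, rfl⟩ := IsIntegrallyClosedIn.algebraMap_eq_of_integral hint
    have ha : a * a = a := hinj (by simpa using hx)
    rcases IsLocalRing.isUnit_or_isUnit_one_sub_self a with h | h
    · right
      rw [h.mul_eq_left.mp ha, map_one]
    · left
      rw [h.mul_left_eq_zero.mp (by rw [mul_sub, ha, mul_one, sub_self] : a * (1 - a) = 0), map_zero]
  have hfield : ∀ x : L, x ≠ 0 → ∃ y, x * y = 1 := by
    intro x hx
    obtain ⟨i, hi⟩ : ∃ i, e x i ≠ 0 := by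
      by_contra! h
      exact hx (e.injective (by ext i; simp [h i]))
    have h1 : e.symm (Pi.single i 1) = 1 := by
      refine (idem _ ?_).resolve_left ?_
      · rw [← map_mul, ← Pi.single_mul, mul_one]
      · intro h
        rw [map_eq_zero_iff _ e.symm.injective] at h
        simpa using congrFun h i
    refine ⟨e.symm (Pi.single i (e x i)⁻¹), ?_⟩
    rw [← h1]
    apply e.injective
    ext j
    by_cases hj : j = i
    · subst hj; simp [hi]
    · simp [hj]
  have hL : IsDomain L := by
    have : NoZeroDivisors L := ⟨fun {a b} hab => by
      by_contra! h
      obtain ⟨y, hy⟩ := hfield a h.1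
      exact h.2 (by rw [← one_mul b, ← hy, mul_right_comm, hab, zero_mul])⟩
    exact NoZeroDivisors.to_isDomain L
  have hA : IsDomain A := hinj.isDomain
  let : Field L := (⟨⟨0, 1, zero_ne_one⟩, mul_comm, fun h => hfield _ h⟩ : IsField L).toField
  refine ⟨hA, ?_⟩
  rw [isIntegrallyClosed_iff (FractionRing A)]
  intro x hx
  let φ : FractionRing A →ₐ[A] L := IsFractionRing.liftAlgHom (g := Algebra.ofId A L) hinj
  obtain ⟨a, ha⟩ := IsIntegrallyClosedIn.algebraMap_eq_of_integral (hx.map φ)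
  exact ⟨a, φ.toRingHom.injective (by simp [ha])⟩

/-- A local ring of a smooth algebra over a field is an integrally closed domain: it is étale over
a polynomial ring `P`, and formation of the integral closure in `Frac P` commutes with étale base
change, so it is integrally closed in a finite product of fields. -/
theorem isDomain_and_isIntegrallyClosed_of_smooth {k T A : Type*} [Field k] [CommRing T]
    [CommRing A] [Algebra k T] [Algebra T A] [Algebra.Smooth k T] (q : Ideal T) [q.IsPrime]
    [IsLocalization.AtPrime A q] : IsDomain A ∧ IsIntegrallyClosed A := by
  have : IsLocalRing A := IsLocalization.AtPrime.isLocalRing A q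
  obtain ⟨f, hf, n, alg, tow, et⟩ :=
    Algebra.IsSmoothAt.exists_isStandardEtale_mvPolynomial (R := k) (p := q)
  have hle : Submonoid.powers f ≤ q.primeCompl := Submonoid.powers_le.mpr hf
  let _ : Algebra (Localization.Away f) A :=
    IsLocalization.localizationAlgebraOfSubmonoidLe _ A (.powers f) q.primeCompl hle
  have : IsScalarTower T (Localization.Away f) A :=
    IsLocalization.localization_isScalarTower_of_submonoid_le _ A (.powers f) q.primeCompl hle
  have hloc : IsLocalization (q.primeCompl.map (algebraMap T (Localization.Away f))) A :=
    IsLocalization.isLocalization_of_submonoid_le _ A (.powers f) q.primeCompl hle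
  let P := MvPolynomial (Fin n) k
  let F := FractionRing P
  let _ : Algebra P A := ((algebraMap (Localization.Away f) A).comp
    (algebraMap P (Localization.Away f))).toAlgebra
  have : IsScalarTower P (Localization.Away f) A := .of_algebraMap_eq' rfl
  have hbij : Function.Bijective (TensorProduct.toIntegralClosure P A F) :=
    TensorProduct.toIntegralClosure_bijective_of_tower (S := Localization.Away f)
      TensorProduct.toIntegralClosure_bijective_of_smooth
      (TensorProduct.toIntegralClosure_bijective_of_isLocalization
        (q.primeCompl.map (algebraMap T (Localization.Away f))))
  have : Algebra.FormallyEtale (Localization.Away f) A := .of_isLocalization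
    (q.primeCompl.map (algebraMap T (Localization.Away f)))
  have : Algebra.FormallyEtale P A := .comp P (Localization.Away f) A
  have : Algebra.EssFiniteType (Localization.Away f) A := .of_isLocalization A
    (q.primeCompl.map (algebraMap T (Localization.Away f)))
  have : Algebra.EssFiniteType P A := .comp P (Localization.Away f) A
  have : Module.Flat (Localization.Away f) A := IsLocalization.flat A
    (q.primeCompl.map (algebraMap T (Localization.Away f)))
  have : Module.Flat P (Localization.Away f) := inferInstance
  have : Module.Flat P A := .trans P (Localization.Away f) A
  -- `F ⊗ A` is essentially of finite type and étale over the field `F`, so a product of fields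
  obtain ⟨I, _, Fi, _, _, e, -⟩ :=
    (Algebra.FormallyEtale.iff_exists_algEquiv_prod F (F ⊗[P] A)).mp inferInstance
  have : IsIntegrallyClosedIn A (A ⊗[P] F) := by
    constructor
    · exact Algebra.TensorProduct.includeLeft_injective (S := A) (IsFractionRing.injective P F)
    · intro x
      refine ⟨fun hx => ?_, fun ⟨y, hy⟩ => hy ▸ isIntegral_algebraMap⟩
      obtain ⟨z, hz⟩ := hbij.2 ⟨x, hx⟩
      have key : ∀ z : A ⊗[P] integralClosure P F, ∃ y : A,
          algebraMap A (A ⊗[P] F) y = (TensorProduct.toIntegralClosure P A F z : A ⊗[P] F) := by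
        intro z
        induction z with
        | zero => exact ⟨0, by simp⟩
        | add z w hz hw =>
          obtain ⟨a, ha⟩ := hz
          obtain ⟨b, hb⟩ := hw
          exact ⟨a + b, by simp [ha, hb]⟩
        | tmul a b =>
          obtain ⟨p, hp⟩ := (IsIntegrallyClosed.isIntegral_iff (R := P) (K := F)).mp b.2
          refine ⟨p • a, ?_⟩
          have : (TensorProduct.toIntegralClosure P A F (a ⊗ₜ b) : A ⊗[P] F) = a ⊗ₜ b.1 := rfl
          rw [this, ← hp, Algebra.TensorProduct.algebraMap_apply, Algebra.algebraMap_self_apply,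
            TensorProduct.smul_tmul, Algebra.smul_def, mul_one]
      obtain ⟨y, hy⟩ := key z
      exact ⟨y, by rw [hy, hz]⟩
  exact isDomain_and_isIntegrallyClosed_of_ringEquiv_pi
    ((Algebra.TensorProduct.comm P A F).toRingEquiv.trans e.toRingEquiv)

/-! ### Regularity in codimension one, and differentials -/

/-- **Algebraic Hartogs**: over a Noetherian domain with integrally closed localizations, an
element of the fraction field that lies in every localization which is a principal ideal ring
lies in the domain. -/
theorem exists_algebraMap_eq_of_forall_isPrincipalIdealRing {R K : Type*} [CommRing R] [IsDomain R]
    [IsNoetherianRing R] [Field K] [Algebra R K] [IsFractionRing R K]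
    (hn : ∀ (p : Ideal R) [p.IsPrime], IsIntegrallyClosed (Localization.AtPrime p)) (g : K)
    (hg : ∀ (p : Ideal R) [p.IsPrime], IsPrincipalIdealRing (Localization.AtPrime p) →
      ∃ a b : R, b ∉ p ∧ algebraMap R K b * g = algebraMap R K a) :
    ∃ r, algebraMap R K r = g := by
  by_contra hne
  let N : Submodule R K := LinearMap.range (Algebra.linearMap R K)
  let J : K → Ideal R := fun x => N.comap (LinearMap.toSpanSingleton R K x)
  have hJ : ∀ x r, r ∈ J x ↔ r • x ∈ N := fun x r => Iff.rfl
  -- a maximal denominator ideal among those of the multiples of `g` is prime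
  obtain ⟨p, ⟨r, hr, rfl⟩, hmax⟩ := set_has_maximal_iff_noetherian.mpr
    (inferInstance : IsNoetherian R R) {I | ∃ r : R, r • g ∉ N ∧ I = J (r • g)}
    ⟨_, 1, by simpa [N] using hne, rfl⟩
  obtain ⟨x, hx⟩ : ∃ x, x = r • g := ⟨_, rfl⟩
  rw [← hx] at hr hmax
  have hp : (J x).IsPrime := by
    refine ⟨fun h => hr ?_, fun {a b} hab => or_iff_not_imp_left.mpr fun ha => ?_⟩
    · simpa using (hJ x 1).mp (h ▸ trivial)
    · have hle : J x ≤ J (a • x) := fun c hc => by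
        rw [hJ, smul_comm]; exact N.smul_mem _ hc
      have := hmax (J (a • x)) ⟨a * r, by rwa [mul_smul, ← hx], by rw [mul_smul, ← hx]⟩
      rw [eq_of_le_of_not_lt hle this, hJ, smul_smul, mul_comm]
      exact hab
  -- the localization at this prime turns out to be principal, which contradicts `hg`
  let A := Localization.AtPrime (J x)
  have hle : (J x).primeCompl ≤ nonZeroDivisors R := (J x).primeCompl_le_nonZeroDivisors
  let _ : Algebra A K := IsLocalization.localizationAlgebraOfSubmonoidLe A K _ _ hle
  have : IsScalarTower R A K := IsLocalization.localization_isScalarTower_of_submonoid_le A K _ _ hle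
  have : IsFractionRing A K :=
    IsFractionRing.isFractionRing_of_isDomain_of_isLocalization (J x).primeCompl A K
  have : IsIntegrallyClosed A := hn (J x)
  have : IsNoetherianRing A := IsLocalization.isNoetherianRing (J x).primeCompl A inferInstance
  have hxA : ∀ a : A, algebraMap A K a ≠ x := by
    intro a hax
    obtain ⟨⟨c, s⟩, hcs⟩ := IsLocalization.surj (J x).primeCompl a
    refine s.2 ((hJ _ _).mpr ⟨c, ?_⟩)
    have := congrArg (algebraMap A K) hcs
    rw [map_mul, ← IsScalarTower.algebraMap_apply, ← IsScalarTower.algebraMap_apply] at this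
    rw [Algebra.linearMap_apply, ← this, hax]
    simp only [Algebra.smul_def, mul_comm]
  have hmx : ∀ t ∈ IsLocalRing.maximalIdeal A, ∃ a : A, algebraMap A K a = algebraMap A K t * x := by
    intro t ht
    obtain ⟨⟨c, s⟩, hcs⟩ := IsLocalization.surj (J x).primeCompl t
    have hc : c ∈ J x := by
      rw [← IsLocalization.AtPrime.to_map_mem_maximal_iff A (J x), ← hcs]
      exact Ideal.mul_mem_right _ _ ht
    obtain ⟨d, hd⟩ := (hJ _ _).mp hc
    refine ⟨IsLocalization.mk' A d s, ?_⟩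
    have hs : algebraMap R K s ≠ 0 := by
      rw [Ne, FaithfulSMul.algebraMap_eq_zero_iff]
      exact nonZeroDivisors.ne_zero (hle s.2)
    apply mul_right_cancel₀ hs
    have h1 := congrArg (algebraMap A K) hcs
    have h2 := congrArg (algebraMap A K) (IsLocalization.mk'_spec A d s)
    simp only [map_mul, ← IsScalarTower.algebraMap_apply] at h1 h2
    rw [h2, mul_right_comm, h1, ← Algebra.smul_def]
    exact hd
  have hprin : IsPrincipalIdealRing A := by
    refine ((tfae_of_isNoetherianRing_of_isLocalRing_of_isDomain A).out 4 0).mp ?_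
    -- if multiplication by `x` preserves the maximal ideal, then `x` is integral by the
    -- Cayley-Hamilton theorem; otherwise some `t * x` is a unit and `t` generates the maximal ideal
    by_cases hcase : ∀ t ∈ IsLocalRing.maximalIdeal A, ∀ a : A,
        algebraMap A K a = algebraMap A K t * x → a ∈ IsLocalRing.maximalIdeal A
    · exfalso
      have hm : IsLocalRing.maximalIdeal A ≠ ⊥ := by
        intro h
        rw [← IsLocalRing.isField_iff_maximalIdeal_eq] at h
        obtain ⟨a, ha⟩ := (IsFractionRing.surjective_iff_isField (R := A) (K := K)).mpr h x
        exact hxA a ha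
      have hint : IsIntegral A x := by
        refine isIntegral_of_smul_mem_submodule
          (Submodule.map (Algebra.linearMap A K) (IsLocalRing.maximalIdeal A)) ?_
          (Submodule.FG.map _ (IsNoetherian.noetherian _)) x ?_
        · intro h
          refine hm (eq_bot_iff.mpr fun a ha => ?_)
          have := Submodule.mem_map_of_mem (f := Algebra.linearMap A K) ha
          rwa [h, Submodule.mem_bot, Algebra.linearMap_apply,
            FaithfulSMul.algebraMap_eq_zero_iff] at this
        · rintro _ ⟨t, ht, rfl⟩
          obtain ⟨a, ha⟩ := hmx t ht
          exact ⟨a, hcase t ht a ha, by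
            rw [Algebra.linearMap_apply, ha, smul_eq_mul, mul_comm, Algebra.linearMap_apply]⟩
      obtain ⟨a, ha⟩ := IsIntegrallyClosed.isIntegral_iff.mp hint
      exact hxA a ha
    · push Not at hcase
      obtain ⟨t, ht, u, hu, hum⟩ := hcase
      obtain ⟨u, rfl⟩ : IsUnit u := by simpa using hum
      refine ⟨⟨t, le_antisymm (fun s hs => ?_) ((Ideal.span_singleton_le_iff_mem _).mpr ht)⟩⟩
      obtain ⟨a, ha⟩ := hmx s hs
      refine Ideal.mem_span_singleton'.mpr ⟨a * (u⁻¹ : Aˣ), ?_⟩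
      have hsu : s * u = a * t := by
        apply FaithfulSMul.algebraMap_injective A K
        rw [map_mul, map_mul, hu, ha]
        ring
      rw [mul_right_comm, ← hsu, mul_assoc, Units.mul_inv, mul_one]
  obtain ⟨a, b, hb, hab⟩ := hg (J x) hprin
  refine hb ((hJ _ _).mpr ⟨r * a, ?_⟩)
  rw [Algebra.linearMap_apply, map_mul, ← hab, hx, Algebra.smul_def, Algebra.smul_def]
  ring

/-- The conormal map of a formally smooth local algebra over a perfect field is injective: an
element of the maximal ideal whose differential vanishes at the closed point lies in the square of
the maximal ideal. -/
theorem IsLocalRing.mem_maximalIdeal_sq_of_D_mem {k A : Type*} [Field k] [PerfectField k]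
    [CommRing A] [IsLocalRing A] [Algebra k A] [Algebra.FormallySmooth k A]
    [Algebra.EssFiniteType k A] {t : A} (ht : t ∈ maximalIdeal A)
    (hD : KaehlerDifferential.D k A t ∈ maximalIdeal A • (⊤ : Submodule A (Ω[A⁄k]))) :
    t ∈ maximalIdeal A ^ 2 := by
  have : Algebra.EssFiniteType k (ResidueField A) := .comp k A (ResidueField A)
  have hs : Function.Surjective (algebraMap A (ResidueField A)) := residue_surjective
  obtain ⟨l, hl⟩ := (Algebra.FormallySmooth.iff_split_injection (R := k) hs).mp inferInstance
  have hker : RingHom.ker (algebraMap A (ResidueField A)) = maximalIdeal A := ker_residue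
  have ht' : t ∈ RingHom.ker (algebraMap A (ResidueField A)) := hker ▸ ht
  have hzero : ∀ ω ∈ maximalIdeal A • (⊤ : Submodule A (Ω[A⁄k])),
      (1 : ResidueField A) ⊗ₜ[A] ω = 0 := by
    intro ω hω
    induction hω using Submodule.smul_induction_on' with
    | smul a ha ω _ =>
      rw [← TensorProduct.smul_tmul, Algebra.smul_def, mul_one]
      have : algebraMap A (ResidueField A) a = 0 := (residue_eq_zero_iff a).mpr ha
      rw [this, TensorProduct.zero_tmul]
    | add x _ y _ hx hy => rw [TensorProduct.tmul_add, hx, hy, add_zero]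
  have h0 := LinearMap.congr_fun hl (Ideal.toCotangent _ ⟨t, ht'⟩)
  rw [LinearMap.comp_apply, KaehlerDifferential.kerCotangentToTensor_toCotangent, hzero _ hD,
    map_zero, LinearMap.id_apply, eq_comm, Ideal.toCotangent_eq_zero] at h0
  exact hker ▸ h0

/-- If a local homomorphism `A → B` carries a basis of the differentials of `A` to a basis of the
differentials of `B`, and the maximal ideal of `B` is principal, then so is that of `A`: the
differentials at the closed point of any two elements of the maximal ideal of `A` are proportional
to the differential of a uniformizer of `B`. -/
theorem IsLocalRing.isPrincipal_maximalIdeal_of_basis_kaehlerDifferential {k A B ι : Type*}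
    [Field k] [PerfectField k] [CommRing A] [IsLocalRing A] [IsNoetherianRing A] [Algebra k A]
    [Algebra.FormallySmooth k A] [Algebra.EssFiniteType k A]
    [CommRing B] [IsLocalRing B] [Algebra k B] [Algebra A B] [IsScalarTower k A B]
    [IsLocalHom (algebraMap A B)] (hB : (maximalIdeal B).IsPrincipal) [Finite ι]
    (a : Module.Basis ι A (Ω[A⁄k])) (b : Module.Basis ι B (Ω[B⁄k]))
    (hab : ∀ i, KaehlerDifferential.map k k A B (a i) = b i) :
    (maximalIdeal A).IsPrincipal := by
  classical
  have := Fintype.ofFinite ι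
  have hmem : ∀ x : A, algebraMap A B x ∈ maximalIdeal B ↔ x ∈ maximalIdeal A := by
    intro x
    rw [mem_maximalIdeal, mem_maximalIdeal, mem_nonunits_iff, mem_nonunits_iff,
      isUnit_map_iff]
  -- the coordinates of differentials
  let c : A → ι → A := fun t => a.repr (KaehlerDifferential.D k A t)
  have hcB : ∀ t i, algebraMap A B (c t i) = b.repr (KaehlerDifferential.D k B (algebraMap A B t)) i := by
    intro t i
    have h1 : KaehlerDifferential.D k B (algebraMap A B t) =
        ∑ j, algebraMap A B (c t j) • b j := by
      rw [← KaehlerDifferential.map_D k k A B, ← a.sum_repr (KaehlerDifferential.D k A t), map_sum]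
      refine Finset.sum_congr rfl fun j _ => ?_
      rw [map_smul, hab, algebraMap_smul]
    rw [h1, b.repr_sum_self]
  have hc : ∀ t ∈ maximalIdeal A, (∀ i, c t i ∈ maximalIdeal A) → t ∈ maximalIdeal A ^ 2 := by
    intro t ht h
    refine mem_maximalIdeal_sq_of_D_mem (k := k) ht ?_
    rw [← a.sum_repr (KaehlerDifferential.D k A t)]
    exact Submodule.sum_mem _ fun i _ => Submodule.smul_mem_smul (h i) trivial
  have hnak : ∀ t₀ ∈ maximalIdeal A,
      maximalIdeal A ≤ Ideal.span {t₀} ⊔ maximalIdeal A ^ 2 → (maximalIdeal A).IsPrincipal := by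
    intro t₀ ht₀ h
    refine ⟨t₀, le_antisymm ?_ ((Ideal.span_singleton_le_iff_mem _).mpr ht₀)⟩
    refine Submodule.le_of_le_smul_of_le_jacobson_bot (I := maximalIdeal A)
      (IsNoetherian.noetherian _) (maximalIdeal_le_jacobson _) ?_
    rwa [pow_two] at h
  have hnak' : maximalIdeal A ≤ maximalIdeal A ^ 2 → (maximalIdeal A).IsPrincipal := fun h =>
    hnak 0 (zero_mem _) (h.trans le_sup_right)
  obtain ⟨π, hπ⟩ := hB
  have hπm : π ∈ maximalIdeal B := hπ ▸ Submodule.mem_span_singleton_self π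
  -- differentials of multiples of an element of the maximal ideal, in coordinates, modulo the latter
  have hv : ∀ ϖ ∈ maximalIdeal B, ∀ v i, b.repr (KaehlerDifferential.D k B (v * ϖ)) i -
      v * b.repr (KaehlerDifferential.D k B ϖ) i ∈ maximalIdeal B := by
    intro ϖ hϖ v i
    rw [Derivation.leibniz, map_add, map_smul, map_smul, Finsupp.add_apply, Finsupp.smul_apply,
      Finsupp.smul_apply, smul_eq_mul, smul_eq_mul, add_sub_cancel_left]
    exact Ideal.mul_mem_right _ _ hϖ
  -- either all differentials of the maximal ideal vanish at the closed point, or some element `t₀`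
  -- of it is carried to a uniformizer of `B`
  by_cases hall : ∀ t ∈ maximalIdeal A, ∀ i, c t i ∈ maximalIdeal A
  · exact hnak' fun t ht => hc t ht (hall t ht)
  push Not at hall
  obtain ⟨t₀, ht₀, j, hj⟩ := hall
  obtain ⟨w, hw⟩ := Ideal.mem_span_singleton'.mp (hπ ▸ (hmem t₀).mpr ht₀ : _ ∈ Ideal.span {π})
  have hwu : IsUnit w := by
    by_contra h
    refine hj ((hmem _).mp ?_)
    rw [hcB, ← hw]
    have := Ideal.add_mem _ (hv π hπm w j) (Ideal.mul_mem_right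
      (b.repr (KaehlerDifferential.D k B π) j) _ ((mem_maximalIdeal w).mpr h))
    rwa [sub_add_cancel] at this
  obtain ⟨u, hu⟩ : IsUnit (c t₀ j) := by simpa using hj
  refine hnak t₀ ht₀ fun t ht => ?_
  obtain ⟨v, hv'⟩ : ∃ v, v * algebraMap A B t₀ = algebraMap A B t := by
    obtain ⟨v, hv⟩ := Ideal.mem_span_singleton'.mp (hπ ▸ (hmem t).mpr ht : _ ∈ Ideal.span {π})
    obtain ⟨w, rfl⟩ := hwu
    exact ⟨v * (w⁻¹ : Bˣ), by rw [← hw, mul_assoc, Units.inv_mul_cancel_left, hv]⟩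
  have ht₀B := (hmem t₀).mpr ht₀
  -- the quotient `t / t₀` agrees with an element of `A` modulo the maximal ideal of `B`
  let s : A := c t j * (u⁻¹ : Aˣ)
  have hs : s * c t₀ j = c t j := by rw [← hu, mul_assoc, Units.inv_mul, mul_one]
  have hvs : v - algebraMap A B s ∈ maximalIdeal B := by
    have h1 := hv _ ht₀B v j
    rw [hv', ← hcB, ← hcB, ← hs, map_mul, ← sub_mul, ← hu] at h1
    have h2 := (Ideal.IsPrime.mem_or_mem inferInstance h1).resolve_right
      fun h => (mem_maximalIdeal _).mp h (u.isUnit.map (algebraMap A B))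
    rw [← neg_sub]
    exact neg_mem h2
  have hts : t - s * t₀ ∈ maximalIdeal A ^ 2 := by
    refine hc _ (sub_mem ht (Ideal.mul_mem_left _ _ ht₀)) fun i => (hmem _).mp ?_
    have h1 : algebraMap A B (t - s * t₀) = (v - algebraMap A B s) * algebraMap A B t₀ := by
      rw [map_sub, map_mul, ← hv', sub_mul]
    rw [hcB, h1]
    have := Ideal.add_mem _ (hv _ ht₀B (v - algebraMap A B s) i) (Ideal.mul_mem_right
      (b.repr (KaehlerDifferential.D k B (algebraMap A B t₀)) i) _ hvs)
    rwa [sub_add_cancel] at this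
  rw [← add_sub_cancel (s * t₀) t]
  exact Submodule.add_mem_sup (Ideal.mul_mem_left _ _ (Ideal.mem_span_singleton_self t₀)) hts

/-! ### Semilinear maps on exterior powers and on differential forms -/

namespace exteriorPower

variable {R S T M N P : Type*} [CommRing R] [CommRing S] [CommRing T] [AddCommGroup M]
  [AddCommGroup N] [AddCommGroup P] [Module R M] [Module S N] [Module T P]

/-- The semilinear map `m₁ ∧ ⋯ ∧ mₙ ↦ g m₁ ∧ ⋯ ∧ g mₙ` on exterior powers induced by a semilinear
map `g`. -/
noncomputable def semilinearMap {σ : R →+* S} (n : ℕ) (g : M →ₛₗ[σ] N) :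
    ⋀[R]^n M →ₛₗ[σ] ⋀[S]^n N :=
  letI : Module R (⋀[S]^n N) := Module.compHom _ σ
  haveI hupd : ∀ [DecidableEq (Fin n)] (m : Fin n → M) (i : Fin n) (x : M),
      (fun j => g (Function.update m i x j)) = Function.update (fun j => g (m j)) i (g x) := by
    intro _ m i x
    funext j
    by_cases h : j = i
    · subst h; simp
    · simp [h]
  letI w : M [⋀^Fin n]→ₗ[R] ⋀[S]^n N :=
    { toFun := fun m => ιMulti S n (fun i => g (m i))
      map_update_add' := fun m i x y => by
        rw [hupd, hupd, hupd, map_add, AlternatingMap.map_update_add]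
      map_update_smul' := fun m i c x => by
        rw [hupd, hupd, map_smulₛₗ, AlternatingMap.map_update_smul]
        rfl
      map_eq_zero_of_eq' := fun m i j h hij =>
        (ιMulti S n).map_eq_zero_of_eq _ (congrArg g h) hij }
  { toFun := alternatingMapLinearEquiv w
    map_add' := map_add _
    map_smul' := fun c x => map_smul (alternatingMapLinearEquiv w) c x }

@[simp]
theorem semilinearMap_ιMulti {σ : R →+* S} (n : ℕ) (g : M →ₛₗ[σ] N) (m : Fin n → M) :
    semilinearMap n g (ιMulti R n m) = ιMulti S n (fun i => g (m i)) :=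
  letI : Module R (⋀[S]^n N) := Module.compHom _ σ
  alternatingMapLinearEquiv_apply_ιMulti _ m

theorem induction_on {n : ℕ} {p : ⋀[R]^n M → Prop} (x : ⋀[R]^n M) (zero : p 0)
    (add : ∀ x y, p x → p y → p (x + y)) (smul : ∀ (r : R) x, p x → p (r • x))
    (mk : ∀ m, p (ιMulti R n m)) : p x := by
  have hx : x ∈ Submodule.span R (Set.range (ιMulti R n (M := M))) := by
    rw [ιMulti_span]; trivial
  induction hx using Submodule.span_induction with
  | mem x h => obtain ⟨m, rfl⟩ := h; exact mk m
  | zero => exact zero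
  | add x y _ _ hx hy => exact add x y hx hy
  | smul r x _ hx => exact smul r x hx

theorem semilinearMap_semilinearMap {σ : R →+* S} {τ : S →+* T} {ρ : R →+* T} (n : ℕ)
    (g : M →ₛₗ[σ] N) (h : N →ₛₗ[τ] P) (l : M →ₛₗ[ρ] P) (hσ : ∀ r, τ (σ r) = ρ r)
    (hl : ∀ m, h (g m) = l m) (x : ⋀[R]^n M) :
    semilinearMap n h (semilinearMap n g x) = semilinearMap n l x := by
  induction x using induction_on with
  | zero => simp
  | add x y hx hy => simp only [map_add, hx, hy]
  | smul r x hx => rw [map_smulₛₗ, map_smulₛₗ, map_smulₛₗ, hx, hσ]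
  | mk m => simp [hl]

theorem semilinearMap_eq_self {σ : R →+* R} (n : ℕ) (g : M →ₛₗ[σ] M) (hσ : ∀ r, σ r = r)
    (hg : ∀ m, g m = m) (x : ⋀[R]^n M) : semilinearMap n g x = x := by
  induction x using induction_on with
  | zero => simp
  | add x y hx hy => simp only [map_add, hx, hy]
  | smul r x hx => rw [map_smulₛₗ, hx, hσ]
  | mk m => simp [hg]

theorem ιMulti_eq_det_smul {n : ℕ} (b : Module.Basis (Fin n) R M) (v : Fin n → M) :
    ιMulti R n v = b.det v • ιMulti R n b := by
  have : ιMulti R n (M := M) =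
      (LinearMap.toSpanSingleton R _ (ιMulti R n b)).compAlternatingMap b.det := by
    refine b.ext_alternating fun w hw => ?_
    let e : Equiv.Perm (Fin n) := Equiv.ofBijective w (Finite.injective_iff_bijective.mp hw)
    change ιMulti R n (b ∘ e) = b.det (b ∘ e) • ιMulti R n b
    rw [AlternatingMap.map_perm, AlternatingMap.map_perm, b.det_self, smul_assoc, one_smul]
  exact congrArg (· v) this

theorem exists_eq_smul_ιMulti {n : ℕ} (b : Module.Basis (Fin n) R M) (s : ⋀[R]^n M) :
    ∃ c : R, s = c • ιMulti R n b := by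
  induction s using induction_on with
  | zero => exact ⟨0, by simp⟩
  | add x y hx hy =>
    obtain ⟨c, hc⟩ := hx
    obtain ⟨d, hd⟩ := hy
    exact ⟨c + d, by rw [add_smul, ← hc, ← hd]⟩
  | smul r x hx =>
    obtain ⟨c, hc⟩ := hx
    exact ⟨r * c, by rw [mul_smul, ← hc]⟩
  | mk m => exact ⟨_, ιMulti_eq_det_smul b m⟩

/-- The linear form on the top exterior power determined by a basis. -/
noncomputable def detForm {n : ℕ} (b : Module.Basis (Fin n) R M) : ⋀[R]^n M →ₗ[R] R :=
  alternatingMapLinearEquiv b.det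

@[simp]
theorem detForm_ιMulti {n : ℕ} (b : Module.Basis (Fin n) R M) (v : Fin n → M) :
    detForm b (ιMulti R n v) = b.det v :=
  alternatingMapLinearEquiv_apply_ιMulti _ v

theorem isUnit_detForm {n : ℕ} (b : Module.Basis (Fin n) R M) {s : ⋀[R]^n M}
    (hs : Submodule.span R {s} = ⊤) : IsUnit (detForm b s) := by
  obtain ⟨r, hr⟩ := Submodule.mem_span_singleton.mp
    (hs ▸ trivial : ιMulti R n b ∈ Submodule.span R {s})
  refine IsUnit.of_mul_eq_one r ?_
  rw [mul_comm, ← smul_eq_mul, ← map_smul, hr, detForm_ιMulti, b.det_self]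

/-- A semilinear map carrying a generator of the top exterior power to a generator carries a basis
to a basis. -/
theorem exists_basis_of_semilinearMap_eq {σ : R →+* S} {n : ℕ} (g : M →ₛₗ[σ] N)
    (a : Module.Basis (Fin n) R M) (b : Module.Basis (Fin n) S N) {s : ⋀[R]^n M} {t : ⋀[S]^n N}
    (ht : Submodule.span S {t} = ⊤) {u : S} (hu : IsUnit u) (h : semilinearMap n g s = u • t) :
    ∃ b' : Module.Basis (Fin n) S N, ∀ i, g (a i) = b' i := by
  obtain ⟨c, rfl⟩ := exists_eq_smul_ιMulti a s
  have h1 := congrArg (detForm b) h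
  rw [map_smulₛₗ, semilinearMap_ιMulti, map_smul, map_smul, detForm_ιMulti, smul_eq_mul,
    smul_eq_mul] at h1
  have hdet : IsUnit (b.det fun i => g (a i)) :=
    isUnit_of_mul_isUnit_right (h1 ▸ hu.mul (isUnit_detForm b ht))
  obtain ⟨hli, hsp⟩ := (b.is_basis_iff_det).mpr hdet
  exact ⟨Module.Basis.mk hli hsp.ge, fun i => by simp⟩

end exteriorPower

section Kaehler

variable {k A B C : Type*} [CommRing k] [CommRing A] [CommRing B] [CommRing C] [Algebra k A]
  [Algebra k B] [Algebra k C]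

/-- The map on Kähler differentials induced by an algebra homomorphism `φ`, as a `φ`-semilinear
map. -/
noncomputable def KaehlerDifferential.semilinearMap (φ : A →ₐ[k] B) :
    Ω[A⁄k] →ₛₗ[(φ : A →+* B)] Ω[B⁄k] :=
  letI := φ.toRingHom.toAlgebra
  haveI : IsScalarTower k A B := .of_algebraMap_eq' φ.comp_algebraMap.symm
  { toFun := KaehlerDifferential.map k k A B
    map_add' := map_add _
    map_smul' := fun a x => by
      rw [map_smul, ← algebraMap_smul B]
      rfl }

@[simp]
theorem KaehlerDifferential.semilinearMap_D (φ : A →ₐ[k] B) (a : A) :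
    KaehlerDifferential.semilinearMap φ (D k A a) = D k B (φ a) :=
  letI := φ.toRingHom.toAlgebra
  haveI : IsScalarTower k A B := .of_algebraMap_eq' φ.comp_algebraMap.symm
  KaehlerDifferential.map_D k k A B a

theorem KaehlerDifferential.induction_on {p : Ω[A⁄k] → Prop} (x : Ω[A⁄k]) (zero : p 0)
    (add : ∀ x y, p x → p y → p (x + y)) (smul : ∀ (r : A) x, p x → p (r • x))
    (D : ∀ a, p (D k A a)) : p x := by
  have hx : x ∈ Submodule.span A (Set.range (KaehlerDifferential.D k A)) := by
    rw [KaehlerDifferential.span_range_derivation]; trivial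
  induction hx using Submodule.span_induction with
  | mem x h => obtain ⟨m, rfl⟩ := h; exact D m
  | zero => exact zero
  | add x y _ _ hx hy => exact add x y hx hy
  | smul r x _ hx => exact smul r x hx

theorem KaehlerDifferential.semilinearMap_semilinearMap (φ : A →ₐ[k] B) (ψ : B →ₐ[k] C)
    (χ : A →ₐ[k] C) (h : ∀ a, ψ (φ a) = χ a) (x : Ω[A⁄k]) :
    semilinearMap ψ (semilinearMap φ x) = semilinearMap χ x := by
  induction x using KaehlerDifferential.induction_on with
  | zero => simp
  | add x y hx hy => simp only [map_add, hx, hy]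
  | smul r x hx => rw [map_smulₛₗ, map_smulₛₗ, map_smulₛₗ, hx]; simp [h]
  | D a => simp [h]

/-- The map on differential `n`-forms induced by an algebra homomorphism. -/
noncomputable def KaehlerDifferential.formMap (n : ℕ) (φ : A →ₐ[k] B) :
    ⋀[A]^n Ω[A⁄k] →ₛₗ[(φ : A →+* B)] ⋀[B]^n Ω[B⁄k] :=
  exteriorPower.semilinearMap n (KaehlerDifferential.semilinearMap φ)

theorem KaehlerDifferential.formMap_formMap (n : ℕ) (φ : A →ₐ[k] B) (ψ : B →ₐ[k] C)
    (χ : A →ₐ[k] C) (h : ∀ a, ψ (φ a) = χ a) (x : ⋀[A]^n Ω[A⁄k]) :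
    formMap n ψ (formMap n φ x) = formMap n χ x :=
  exteriorPower.semilinearMap_semilinearMap n _ _ _ h
    (KaehlerDifferential.semilinearMap_semilinearMap φ ψ χ h) x

theorem KaehlerDifferential.formMap_eq_self (n : ℕ) (φ : A →ₐ[k] A) (h : ∀ a, φ a = a)
    (x : ⋀[A]^n Ω[A⁄k]) : formMap n φ x = x := by
  refine exteriorPower.semilinearMap_eq_self n (KaehlerDifferential.semilinearMap φ)
    (σ := (φ : A →+* A)) h (fun m => ?_) x
  induction m using KaehlerDifferential.induction_on with
  | zero => simp
  | add x y hx hy => simp only [map_add, hx, hy]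
  | smul r x hx => rw [map_smulₛₗ, hx]; simp [h]
  | D a => simp [h]

/-- Forms `d a₁ ∧ ⋯ ∧ d aₙ` generate the module of `n`-forms. -/
theorem KaehlerDifferential.form_induction_on {n : ℕ} {p : ⋀[A]^n Ω[A⁄k] → Prop}
    (x : ⋀[A]^n Ω[A⁄k]) (zero : p 0)
    (add : ∀ x y, p x → p y → p (x + y)) (smul : ∀ (r : A) x, p x → p (r • x))
    (mk : ∀ a : Fin n → A, p (exteriorPower.ιMulti A n fun i => KaehlerDifferential.D k A (a i))) :
    p x := by
  classical
  let : LinearOrder A := linearOrderOfSTO WellOrderingRel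
  have hx : x ∈ Submodule.span A (Set.range (exteriorPower.ιMulti_family A n
      (fun a : A => KaehlerDifferential.D k A a))) := by
    rw [exteriorPower.ιMulti_family_span_of_span A
      (KaehlerDifferential.span_range_derivation k A)]
    trivial
  induction hx using Submodule.span_induction with
  | mem x h => obtain ⟨m, rfl⟩ := h; exact mk _
  | zero => exact zero
  | add x y _ _ hx hy => exact add x y hx hy
  | smul r x _ hx => exact smul r x hx

end Kaehler

/-! ### Trivializations of the canonical sheaf in terms of sections -/

namespace AlgebraicGeometry.Scheme
open Opposite

/-- A trivialization of the sheaf of `n`-forms corresponds, under the sheafification adjunction, to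
a locally bijective morphism from the presheaf of `n`-forms to the structure sheaf. -/
theorem HasTrivialCanonicalBundle.exists_presheafHom {k : CommRingCat.{u}} {X : Scheme.{u}}
    {f : X ⟶ Spec k} {n : ℕ} (h : HasTrivialCanonicalBundle f n) :
    ∃ θ : (PresheafOfModules.DifferentialsConstruction.relativeDifferentials'
        (structureHom f)).exteriorPower n ⟶
        (PresheafOfModules.restrictScalars (𝟙 X.ringCatSheaf.obj)).obj
          ((SheafOfModules.forget _).obj X.structureModule),
      Presheaf.IsLocallyInjective (Opens.grothendieckTopology X)
          ((PresheafOfModules.toPresheaf _).map θ) ∧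
      Presheaf.IsLocallySurjective (Opens.grothendieckTopology X)
          ((PresheafOfModules.toPresheaf _).map θ) := by
  obtain ⟨e⟩ := h
  let e' : SheafOfModules.Hom _ _ := e.hom
  let θ := PresheafOfModules.sheafificationHomEquiv (𝟙 X.ringCatSheaf.obj) e'
  refine ⟨θ, ?_⟩
  let M := ((PresheafOfModules.DifferentialsConstruction.relativeDifferentials'
        (structureHom f)).exteriorPower n).presheaf
  let η : M ⟶ (Modules.toPresheaf X).obj (differentialForms f n) :=
    CategoryTheory.toSheafify (Opens.grothendieckTopology X) M
  have h1 : (PresheafOfModules.toPresheaf _).map θ = η ≫ (Modules.toPresheaf X).map e.hom := rfl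
  have : Presheaf.IsLocallyInjective (Opens.grothendieckTopology X) η :=
    Presheaf.isLocallyInjective_toSheafify' (Opens.grothendieckTopology X) M
  have : Presheaf.IsLocallySurjective (Opens.grothendieckTopology X) η :=
    Presheaf.isLocallySurjective_toSheafify' (Opens.grothendieckTopology X) M
  let ε : (Modules.toPresheaf X).obj (differentialForms f n) ⟶
    (Modules.toPresheaf X).obj X.structureModule := (Modules.toPresheaf X).map e.hom
  have : IsIso ε := inferInstanceAs (IsIso ((Modules.toPresheaf X).map e.hom))
  have : Presheaf.IsLocallyInjective (Opens.grothendieckTopology X) ε := inferInstance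
  have : Presheaf.IsLocallySurjective (Opens.grothendieckTopology X) ε := inferInstance
  have h3 : Presheaf.IsLocallyInjective (Opens.grothendieckTopology X) (η ≫ ε) := inferInstance
  have h4 : Presheaf.IsLocallySurjective (Opens.grothendieckTopology X) (η ≫ ε) := inferInstance
  exact ⟨h3, h4⟩

/-- The ring of sections `Γ(X, U)` of a scheme over `Spec k`, viewed as a `k`-algebra. -/
def SectionAlg {k : Type u} [CommRing k] {X : Scheme.{u}}
    (_ : X ⟶ Spec (.of k)) (U : X.Opens) : Type u :=
  Γ(X, U)

/-- The local ring `𝒪_{X, x}` of a scheme over `Spec k`, viewed as a `k`-algebra. -/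
def StalkAlg {k : Type u} [CommRing k] {X : Scheme.{u}}
    (_ : X ⟶ Spec (.of k)) (x : X) : Type u :=
  X.presheaf.stalk x

variable {k : Type u} [CommRing k] {X : Scheme.{u}} (f : X ⟶ Spec (.of k))

noncomputable instance (U : X.Opens) : CommRing (SectionAlg f U) :=
  (X.presheaf.obj (op U)).commRing

noncomputable instance (U : X.Opens) : Algebra k (SectionAlg f U) :=
  ((structureHom f).app (op U)).hom.toAlgebra

noncomputable instance (x : X) : CommRing (StalkAlg f x) :=
  (X.presheaf.stalk x).commRing

instance (x : X) : IsLocalRing (StalkAlg f x) :=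
  inferInstanceAs (IsLocalRing (X.presheaf.stalk x))

noncomputable instance (x : X) : Algebra k (StalkAlg f x) :=
  ((structureHom f).app (op ⊤) ≫ X.presheaf.germ ⊤ x trivial).hom.toAlgebra

/-- Restriction of sections, as a `k`-algebra homomorphism. -/
noncomputable def SectionAlg.res {U V : X.Opens} (h : V ≤ U) :
    SectionAlg f U →ₐ[k] SectionAlg f V :=
  { (X.presheaf.map (homOfLE h).op).hom with
    commutes' := fun r =>
      congr($((structureHom f).naturality (homOfLE h).op) r).symm }

/-- The germ of a section at a point, as a `k`-algebra homomorphism. -/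
noncomputable def SectionAlg.germ (U : X.Opens) (x : X) (hx : x ∈ U) :
    SectionAlg f U →ₐ[k] StalkAlg f x :=
  { (X.presheaf.germ U x hx).hom with
    commutes' := fun r => by
      have h1 := congr($((structureHom f).naturality (homOfLE (le_top : U ≤ ⊤)).op) r)
      have h2 := congr($(X.presheaf.germ_res (homOfLE (le_top : U ≤ ⊤)) x hx)
        ((structureHom f).app (op ⊤) r))
      refine Eq.trans ?_ h2
      exact congrArg (X.presheaf.germ U x hx) h1 }

/-- The specialization map of local rings, as a `k`-algebra homomorphism. -/
noncomputable def StalkAlg.specializes {x y : X} (h : x ⤳ y) :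
    StalkAlg f y →ₐ[k] StalkAlg f x :=
  { (X.presheaf.stalkSpecializes h).hom with
    commutes' := fun r =>
      congr($(X.presheaf.germ_stalkSpecializes (U := ⊤) trivial h)
        ((structureHom f).app (op ⊤) r)) }

variable {f} in
theorem StalkAlg.exists_germ_eq {x : X} (a : StalkAlg f x) :
    ∃ (U : X.Opens) (hx : x ∈ U) (s : SectionAlg f U), SectionAlg.germ f U x hx s = a :=
  X.presheaf.exists_germ_eq a

theorem SectionAlg.germ_res {U V : X.Opens} (h : V ≤ U) (x : X) (hx : x ∈ V)
    (s : SectionAlg f U) :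
    SectionAlg.germ f V x hx (SectionAlg.res f h s) = SectionAlg.germ f U x (h hx) s :=
  congr($(X.presheaf.germ_res (homOfLE h) x hx) s)

theorem StalkAlg.specializes_germ {x y : X} (h : x ⤳ y) (U : X.Opens) (hy : y ∈ U)
    (s : SectionAlg f U) :
    StalkAlg.specializes f h (SectionAlg.germ f U y hy s) =
      SectionAlg.germ f U x (h.mem_open U.2 hy) s :=
  congr($(X.presheaf.germ_stalkSpecializes hy h) s)

end AlgebraicGeometry.Scheme

/-! ### Volume forms -/

namespace AlgebraicGeometry.Scheme
open Opposite

variable {k : Type u} [CommRing k] {X : Scheme.{u}} (f : X ⟶ Spec (.of k))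

/-- The module of `n`-forms of a `k`-algebra. -/
noncomputable abbrev Forms (n : ℕ) (k A : Type*) [CommRing k] [CommRing A] [Algebra k A] :=
  ⋀[A]^n (Ω[A⁄k])

/-- The restriction maps of the presheaf `U ↦ ⋀^n Ω_{Γ(X, U)/k}`. -/
theorem exteriorPower_relativeDifferentials_map_apply (n : ℕ) {U V : X.Opens} (h : V ≤ U)
    (m : Forms n k (SectionAlg f U)) :
    (((PresheafOfModules.DifferentialsConstruction.relativeDifferentials'
      (structureHom f)).exteriorPower n).map (homOfLE h).op).hom m =
      KaehlerDifferential.formMap n (SectionAlg.res f h) m := by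
  let Φ := (((PresheafOfModules.DifferentialsConstruction.relativeDifferentials'
      (structureHom f)).exteriorPower n).map (homOfLE h).op).hom
  induction m using KaehlerDifferential.form_induction_on with
  | zero => exact (map_zero Φ).trans (map_zero _).symm
  | add x y hx hy =>
    exact (map_add Φ x y).trans ((congrArg₂ (· + ·) hx hy).trans (map_add _ x y).symm)
  | smul r x hx =>
    refine (Φ.map_smul' r x).trans (Eq.trans ?_ (map_smulₛₗ _ r x).symm)
    exact congrArg (fun y : Forms n k (SectionAlg f V) => SectionAlg.res f h r • y) hx
  | mk a =>
    refine (exteriorPowerMapRestrict_mk _ _ n _).trans ?_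
    refine Eq.trans ?_ (exteriorPower.semilinearMap_ιMulti n _ _).symm
    refine congrArg (exteriorPower.ιMulti (SectionAlg f V) n (M := Ω[SectionAlg f V⁄k]))
      (funext fun i => ?_)
    refine Eq.trans ?_ (KaehlerDifferential.semilinearMap_D (SectionAlg.res f h) (a i)).symm
    exact PresheafOfModules.DifferentialsConstruction.relativeDifferentials'_map_d _ _ _

/-- A trivialization of the sheaf of `n`-forms, as a family of linear maps on the modules of
`n`-forms of the rings of sections, which is compatible with restriction, locally injective and
locally surjective. -/
theorem HasTrivialCanonicalBundle.exists_sections {f : X ⟶ Spec (.of k)} {n : ℕ}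
    (h : HasTrivialCanonicalBundle f n) :
    ∃ θ : ∀ U : X.Opens, Forms n k (SectionAlg f U) →ₗ[SectionAlg f U] SectionAlg f U,
      (∀ (U V : X.Opens) (hV : V ≤ U) (m : Forms n k (SectionAlg f U)),
        θ V (KaehlerDifferential.formMap n (SectionAlg.res f hV) m) = SectionAlg.res f hV (θ U m)) ∧
      (∀ (U : X.Opens) (m m' : Forms n k (SectionAlg f U)), θ U m = θ U m' → ∀ x ∈ U,
        ∃ (V : X.Opens) (hV : V ≤ U), x ∈ V ∧
          KaehlerDifferential.formMap n (SectionAlg.res f hV) m =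
            KaehlerDifferential.formMap n (SectionAlg.res f hV) m') ∧
      (∀ (U : X.Opens) (a : SectionAlg f U), ∀ x ∈ U, ∃ (V : X.Opens) (hV : V ≤ U), x ∈ V ∧
        ∃ m, θ V m = SectionAlg.res f hV a) := by
  obtain ⟨θ, hi, hs⟩ := h.exists_presheafHom
  refine ⟨fun U => (θ.app (op U)).hom, ?_, ?_, ?_⟩
  · intro U V hV m
    rw [← exteriorPower_relativeDifferentials_map_apply]
    exact PresheafOfModules.naturality_apply θ (homOfLE hV).op m
  · intro U m m' hm x hx
    obtain ⟨V, g, hg, hxV⟩ := hi.equalizerSieve_mem (X := op U) m m' hm x hx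
    refine ⟨V, g.le, hxV, ?_⟩
    rw [← exteriorPower_relativeDifferentials_map_apply,
      ← exteriorPower_relativeDifferentials_map_apply]
    exact hg
  · intro U a x hx
    obtain ⟨V, g, ⟨m, hm⟩, hxV⟩ := hs.imageSieve_mem (U := U) a x hx
    exact ⟨V, g.le, hxV, m, hm⟩

variable {f} in
/-- Every differential form on a local ring is the germ of a form on some open neighbourhood. -/
theorem StalkAlg.exists_formMap_germ_eq {n : ℕ} {x : X} (ω : Forms n k (StalkAlg f x)) :
    ∃ (U : X.Opens) (hx : x ∈ U) (m : Forms n k (SectionAlg f U)),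
      KaehlerDifferential.formMap n (SectionAlg.germ f U x hx) m = ω := by
  have hres : ∀ {U V : X.Opens} (h : V ≤ U) (hx : x ∈ V) (m : Forms n k (SectionAlg f U)),
      KaehlerDifferential.formMap n (SectionAlg.germ f V x hx)
        (KaehlerDifferential.formMap n (SectionAlg.res f h) m) =
      KaehlerDifferential.formMap n (SectionAlg.germ f U x (h hx)) m := fun h hx m =>
    KaehlerDifferential.formMap_formMap n _ _ _ (SectionAlg.germ_res f h x hx) m
  induction ω using KaehlerDifferential.form_induction_on with
  | zero => exact ⟨⊤, trivial, 0, map_zero _⟩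
  | add ω ω' h h' =>
    obtain ⟨U, hU, m, rfl⟩ := h
    obtain ⟨V, hV, m', rfl⟩ := h'
    have hx : x ∈ U ⊓ V := ⟨hU, hV⟩
    refine ⟨U ⊓ V, hx, KaehlerDifferential.formMap n (SectionAlg.res f inf_le_left) m +
      KaehlerDifferential.formMap n (SectionAlg.res f inf_le_right) m', ?_⟩
    rw [map_add, hres, hres]
  | smul r ω h =>
    obtain ⟨U, hU, m, rfl⟩ := h
    obtain ⟨V, hV, s, rfl⟩ := exists_germ_eq r
    have hx : x ∈ U ⊓ V := ⟨hU, hV⟩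
    refine ⟨U ⊓ V, hx, SectionAlg.res f (inf_le_right : U ⊓ V ≤ V) s •
      KaehlerDifferential.formMap n (SectionAlg.res f (inf_le_left : U ⊓ V ≤ U)) m, ?_⟩
    rw [map_smulₛₗ, hres]
    exact congrArg (fun c : StalkAlg f x => c • _) (SectionAlg.germ_res f inf_le_right x hx s)
  | mk a =>
    choose U hU s hs using fun i => exists_germ_eq (a i)
    have hW : x ∈ (Finset.univ.inf U : X.Opens) := by
      rw [← SetLike.mem_coe, Opens.coe_finset_inf]
      simpa using hU
    refine ⟨Finset.univ.inf U, hW, exteriorPower.ιMulti _ n fun i => KaehlerDifferential.D k _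
      (SectionAlg.res f (Finset.inf_le (Finset.mem_univ i)) (s i)), ?_⟩
    refine (exteriorPower.semilinearMap_ιMulti n _ _).trans ?_
    refine congrArg (exteriorPower.ιMulti _ n) (funext fun i => ?_)
    rw [KaehlerDifferential.semilinearMap_D, SectionAlg.germ_res, hs]

/-- A volume form of `X` over `k`, given by its germs: a compatible family of generators of the
modules of `n`-forms of the local rings. -/
structure VolumeForm (f : X ⟶ Spec (.of k)) (n : ℕ) where
  /-- The germ of the volume form at a point. -/
  germ (x : X) : Forms n k (StalkAlg f x)
  span_germ (x : X) : Submodule.span (StalkAlg f x) {germ x} = ⊤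
  specializes {x y : X} (h : x ⤳ y) :
    KaehlerDifferential.formMap n (StalkAlg.specializes f h) (germ y) = germ x

/-- A trivialization of the canonical bundle, viewed as a volume form: at each point, the germ of
the local sections of the presheaf of forms that represent the generator. -/
theorem HasTrivialCanonicalBundle.nonempty_volumeForm {f : X ⟶ Spec (.of k)} {n : ℕ}
    (h : HasTrivialCanonicalBundle f n) : Nonempty (VolumeForm f n) := by
  obtain ⟨θ, hnat, hinj, hsurj⟩ := h.exists_sections
  have hres : ∀ {x : X} {U V : X.Opens} (h : V ≤ U) (hx : x ∈ V) (m : Forms n k (SectionAlg f U)),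
      KaehlerDifferential.formMap n (SectionAlg.germ f V x hx)
        (KaehlerDifferential.formMap n (SectionAlg.res f h) m) =
      KaehlerDifferential.formMap n (SectionAlg.germ f U x (h hx)) m := fun h hx m =>
    KaehlerDifferential.formMap_formMap n _ _ _ (SectionAlg.germ_res f h _ hx) m
  have hloc : ∀ x : X, ∃ (V : X.Opens) (_ : x ∈ V) (m : _), θ V m = 1 := fun x => by
    obtain ⟨V, hV, hx, m, hm⟩ := hsurj ⊤ 1 x trivial
    exact ⟨V, hx, m, by rw [hm, map_one]⟩
  choose V hxV m hm using hloc
  -- sections with the same image under `θ` have the same germs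
  have hgerm : ∀ {U U' : X.Opens} {x : X} (hx : x ∈ U) (hx' : x ∈ U') (t : _) (t' : _)
      (_ : SectionAlg.res f (inf_le_left : U ⊓ U' ≤ U) (θ U t) =
        SectionAlg.res f (inf_le_right : U ⊓ U' ≤ U') (θ U' t')),
      KaehlerDifferential.formMap n (SectionAlg.germ f U x hx) t =
        KaehlerDifferential.formMap n (SectionAlg.germ f U' x hx') t' := by
    intro U U' x hx hx' t t' heq
    rw [← hnat, ← hnat] at heq
    have hxx : x ∈ U ⊓ U' := ⟨hx, hx'⟩
    obtain ⟨W, hW, hxW, h⟩ := hinj _ _ _ heq x hxx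
    have := congrArg (KaehlerDifferential.formMap n (SectionAlg.germ f W x hxW)) h
    rwa [hres, hres, hres, hres] at this
  refine ⟨⟨fun x => KaehlerDifferential.formMap n (SectionAlg.germ f (V x) x (hxV x)) (m x),
    fun x => ?_, fun {x y} h => ?_⟩⟩
  · rw [eq_top_iff]
    rintro ω -
    obtain ⟨U, hx, t, rfl⟩ := StalkAlg.exists_formMap_germ_eq ω
    rw [Submodule.mem_span_singleton]
    refine ⟨SectionAlg.germ f U x hx (θ U t), ?_⟩
    have hxx : x ∈ U ⊓ V x := ⟨hx, hxV x⟩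
    have h1 := hgerm (U := U ⊓ V x) hxx hx
      (SectionAlg.res f (inf_le_left : U ⊓ V x ≤ U) (θ U t) •
        KaehlerDifferential.formMap n (SectionAlg.res f (inf_le_right : U ⊓ V x ≤ V x)) (m x)) t
      (by
        rw [map_smul, hnat, hm, map_one, smul_eq_mul, mul_one]
        exact congr($(X.presheaf.map_comp (homOfLE _).op (homOfLE _).op) (θ U t)).symm)
    rw [← h1, map_smulₛₗ, hres]
    exact congrArg (fun c : StalkAlg f x => c • _)
      (SectionAlg.germ_res f inf_le_left x hxx (θ U t)).symm
  · rw [KaehlerDifferential.formMap_formMap n _ _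
      (SectionAlg.germ f (V y) x (h.mem_open (V y).2 (hxV y))) (StalkAlg.specializes_germ f h _ _)]
    refine hgerm _ _ _ _ ?_
    rw [hm, hm, map_one, map_one]

end AlgebraicGeometry.Scheme

/-! ### Local rings of smooth schemes -/

/-- The properties of the local rings of a smooth scheme of relative dimension `n` over a field
which are used below. -/
structure IsSmoothLocalAlgebra (n : ℕ) (k A : Type*) [Field k] [CommRing A] [Algebra k A] :
    Prop where
  formallySmooth : Algebra.FormallySmooth k A
  essFiniteType : Algebra.EssFiniteType k A
  isNoetherianRing : IsNoetherianRing A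
  isDomain : IsDomain A
  isIntegrallyClosed : IsIntegrallyClosed A
  nonempty_basis : Nonempty (Module.Basis (Fin n) A Ω[A⁄k])

theorem IsSmoothLocalAlgebra.of_isLocalization (n : ℕ) {k T A : Type u} [Field k] [CommRing T]
    [Algebra k T] [Algebra.IsStandardSmoothOfRelativeDimension n k T] [CommRing A] [Algebra k A]
    [Algebra T A] [IsScalarTower k T A] (q : Ideal T) [q.IsPrime] [IsLocalization.AtPrime A q] :
    IsSmoothLocalAlgebra n k A := by
  have : Algebra.IsStandardSmooth k T :=
    Algebra.IsStandardSmoothOfRelativeDimension.isStandardSmooth n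
  have : Nontrivial T := ⟨⟨0, 1, fun h => ‹q.IsPrime›.ne_top ((Ideal.eq_top_iff_one q).2
    (h ▸ q.zero_mem))⟩⟩
  obtain ⟨hd, hi⟩ := isDomain_and_isIntegrallyClosed_of_smooth (k := k) (A := A) q
  have : IsNoetherianRing T := Algebra.FiniteType.isNoetherianRing k T
  have : Algebra.FormallyEtale T A := Algebra.FormallyEtale.of_isLocalization q.primeCompl
  have : Algebra.EssFiniteType T A := Algebra.EssFiniteType.of_isLocalization _ q.primeCompl
  refine ⟨Algebra.FormallySmooth.comp k T A, Algebra.EssFiniteType.comp k T A,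
    IsLocalization.isNoetherianRing q.primeCompl A inferInstance, hd, hi, ?_⟩
  have hr := Algebra.IsStandardSmoothOfRelativeDimension.rank_kaehlerDifferential (R := k) (S := T) n
  let b := Module.finBasisOfFinrankEq T (Ω[T⁄k]) (Module.finrank_eq_of_rank_eq hr)
  exact ⟨b.ofIsLocalizedModule A q.primeCompl (KaehlerDifferential.map k k T A)⟩

namespace AlgebraicGeometry.Scheme
open Opposite

variable {n : ℕ} {k : Type u} [Field k] {X : Scheme.{u}} (f : X ⟶ Spec (.of k))

theorem exists_isStandardSmooth_sectionAlg [SmoothOfRelativeDimension n f] (x : X) :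
    ∃ V : X.Opens, IsAffineOpen V ∧ x ∈ V ∧
      Algebra.IsStandardSmoothOfRelativeDimension n k (SectionAlg f V) := by
  obtain ⟨U, hU, V, hV, hx, e, h⟩ :=
    SmoothOfRelativeDimension.exists_isStandardSmoothOfRelativeDimension (n := n) (f := f) x
  refine ⟨V, hV, hx, ?_⟩
  have : Subsingleton (Spec (.of k)) := inferInstanceAs (Subsingleton (PrimeSpectrum k))
  have hUt : U = ⊤ := by
    ext y
    simp only [Opens.coe_top, Set.mem_univ, iff_true]
    exact (Subsingleton.elim (f x) y) ▸ e hx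
  subst hUt
  have h2 := h.comp (RingHom.IsStandardSmoothOfRelativeDimension.equiv
    (Scheme.ΓSpecIso (.of k)).symm.commRingCatIsoToRingEquiv)
  rw [add_zero] at h2
  exact h2

theorem isSmoothLocalAlgebra_stalkAlg [SmoothOfRelativeDimension n f] (x : X) :
    IsSmoothLocalAlgebra n k (StalkAlg f x) := by
  obtain ⟨V, hV, hx, h⟩ := exists_isStandardSmooth_sectionAlg (n := n) f x
  let _ : Algebra (SectionAlg f V) (StalkAlg f x) := (SectionAlg.germ f V x hx).toAlgebra
  have : IsScalarTower k (SectionAlg f V) (StalkAlg f x) :=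
    .of_algebraMap_eq' (SectionAlg.germ f V x hx).comp_algebraMap.symm
  let q : Ideal (SectionAlg f V) := (hV.primeIdealOf ⟨x, hx⟩).asIdeal
  have : q.IsPrime := (hV.primeIdealOf ⟨x, hx⟩).2
  have : IsLocalization.AtPrime (StalkAlg f x) q := hV.isLocalization_stalk ⟨x, hx⟩
  exact IsSmoothLocalAlgebra.of_isLocalization n q

end AlgebraicGeometry.Scheme

/-! ### Integral components, and properness of projective schemes -/

namespace AlgebraicGeometry.Scheme

/-- An irreducible component through a point whose local ring is a domain is the closure of the
image of the generic point of the spectrum of the local ring. In particular, there is only one. -/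
theorem eq_closure_of_mem_irreducibleComponents {X : Scheme.{u}} {x : X}
    [IsDomain (X.presheaf.stalk x)] {C : Set X} (hC : C ∈ irreducibleComponents X) (hx : x ∈ C) :
    C = closure {X.fromSpecStalk x (⊥ : PrimeSpectrum (X.presheaf.stalk x))} := by
  have hcl : IsClosed C := isClosed_of_mem_irreducibleComponents C hC
  have hξ : IsGenericPoint (hC.1.genericPoint) C := by
    simpa [hcl.closure_eq] using hC.1.isGenericPoint_genericPoint_closure
  obtain ⟨p, hp⟩ : hC.1.genericPoint ∈ Set.range (X.fromSpecStalk x) := by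
    rw [range_fromSpecStalk]
    exact hξ.specializes hx
  refine le_antisymm ?_ ?_
  · rw [← hξ.def, ← hp]
    refine Specializes.closure_subset (Specializes.map ?_ (X.fromSpecStalk x).continuous)
    exact (PrimeSpectrum.le_iff_specializes _ _).1 bot_le
  · refine hC.2 (isIrreducible_singleton.closure) ?_
    rw [← hξ.def, ← hp]
    refine Specializes.closure_subset (Specializes.map ?_ (X.fromSpecStalk x).continuous)
    exact (PrimeSpectrum.le_iff_specializes _ _).1 bot_le

/-- A Noetherian scheme whose local rings are domains is the disjoint union of its irreducible
components, which are integral. -/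
theorem exists_isIntegral_opens {X : Scheme.{u}} [IsNoetherian X]
    [∀ x : X, IsDomain (X.presheaf.stalk x)] (x : X) :
    ∃ Z : X.Opens, x ∈ Z ∧ IsClosed (Z : Set X) ∧ IsIntegral Z.toScheme := by
  have hfin : (irreducibleComponents X).Finite := NoetherianSpace.finite_irreducibleComponents
  let C := _root_.irreducibleComponent x
  have hC : C ∈ irreducibleComponents X := irreducibleComponent_mem_irreducibleComponents x
  have hopen : IsOpen C := by
    have h : C = (⋃₀ (irreducibleComponents X \ {C}))ᶜ := by
      ext y
      simp only [Set.mem_compl_iff, Set.mem_sUnion, Set.mem_sdiff, Set.mem_singleton_iff, not_exists,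
        not_and, and_imp]
      refine ⟨fun hy D hD hne hyD => hne ?_, fun hy => ?_⟩
      · rw [eq_closure_of_mem_irreducibleComponents hC hy,
          eq_closure_of_mem_irreducibleComponents hD hyD]
      · by_contra hyC
        refine hy (_root_.irreducibleComponent y) (irreducibleComponent_mem_irreducibleComponents y)
          (fun h => hyC (h ▸ mem_irreducibleComponent)) mem_irreducibleComponent
    rw [h, isOpen_compl_iff, Set.sUnion_eq_biUnion]
    exact (hfin.subset Set.sdiff_subset).isClosed_biUnion fun D hD =>
      isClosed_of_mem_irreducibleComponents D hD.1
  let Z : X.Opens := ⟨C, hopen⟩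
  have : IsReduced X := by
    have (y : X) : _root_.IsReduced (X.presheaf.stalk y) := inferInstance
    exact isReduced_of_isReduced_stalk X
  have : IrreducibleSpace Z := Subtype.irreducibleSpace isIrreducible_irreducibleComponent
  exact ⟨Z, mem_irreducibleComponent, isClosed_irreducibleComponent,
    isIntegral_of_irreducibleSpace_of_isReduced _⟩

attribute [local instance] MvPolynomial.gradedAlgebra in
/-- A projective scheme over a field is proper: `ℙ^N` is proper over the spectrum of the ring of
forms of degree zero, which consists of the constants. -/
theorem IsProjectiveOver.isProper {k : Type u} [Field k] {X : Scheme.{u}} {f : X ⟶ Spec (.of k)}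
    (h : IsProjectiveOver f) : IsProper f := by
  obtain ⟨N, i, hi, rfl⟩ := h
  have h1 : Function.Surjective (algebraMap k (projectiveGrading k N 0)) := by
    rintro ⟨p, hp⟩
    exact ⟨_, Subtype.ext (MvPolynomial.totalDegree_eq_zero_iff_eq_C.1
      (Nat.le_zero.1 (MvPolynomial.IsHomogeneous.totalDegree_le hp))).symm⟩
  have : IsScalarTower k (projectiveGrading k N 0) (MvPolynomial (Fin (N + 1)) k) :=
    ⟨fun a b c => smul_mul_assoc a (b : MvPolynomial (Fin (N + 1)) k) c⟩
  have : Algebra.FiniteType (projectiveGrading k N 0) (MvPolynomial (Fin (N + 1)) k) :=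
    Algebra.FiniteType.of_restrictScalars_finiteType k _ _
  have : IsClosedImmersion (Spec.map (CommRingCat.ofHom (algebraMap k (projectiveGrading k N 0)))) :=
    IsClosedImmersion.spec_of_surjective _ h1
  have : IsProper (projectiveSpaceToSpec k N) :=
    inferInstanceAs (IsProper (Proj.toSpecZero (projectiveGrading k N) ≫ Spec.map _))
  infer_instance

theorem isNoetherian_of_isProper {k : Type u} [Field k] {X : Scheme.{u}} (f : X ⟶ Spec (.of k))
    [IsProper f] : IsNoetherian X := by
  have : IsLocallyNoetherian X := LocallyOfFiniteType.isLocallyNoetherian f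
  have : CompactSpace X := QuasiCompact.compactSpace_of_compactSpace f
  exact {}

theorem isClosedImmersion_ι {X : Scheme.{u}} {Z : X.Opens} (h : IsClosed (Z : Set X)) :
    IsClosedImmersion Z.ι := by
  refine IsClosedImmersion.of_isPreimmersion _ ?_
  simpa using h

end AlgebraicGeometry.Scheme

/-! ### Rational functions regular in codimension one on an integral scheme -/

namespace AlgebraicGeometry.Scheme
open Opposite

/-- Hartogs on an affine open subset of an integral scheme. -/
theorem exists_germToFunctionField_eq_of_isAffineOpen {Z : Scheme.{u}} [IsIntegral Z]
    [IsLocallyNoetherian Z] [∀ z : Z, IsIntegrallyClosed (Z.presheaf.stalk z)]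
    {g : Z.functionField}
    (hg : ∀ z : Z, IsPrincipalIdealRing (Z.presheaf.stalk z) →
      ∃ a : Z.presheaf.stalk z, algebraMap (Z.presheaf.stalk z) Z.functionField a = g)
    {V : Z.Opens} (hV : IsAffineOpen V) [Nonempty V] :
    ∃ s : Γ(Z, V), Z.germToFunctionField V s = g := by
  have := functionField_isFractionRing_of_isAffineOpen Z V hV
  have : IsNoetherianRing Γ(Z, V) := IsLocallyNoetherian.component_noetherian ⟨V, hV⟩
  have hloc (p : Ideal Γ(Z, V)) [hp : p.IsPrime] :
      ∃ x : V, IsLocalization.AtPrime (Z.presheaf.stalk x.1) p := by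
    let x : V := hV.isoSpec.inv ⟨p, hp⟩
    have hx : hV.primeIdealOf x = ⟨p, hp⟩ :=
      congr($(hV.isoSpec.inv_hom_id) (⟨p, hp⟩ : PrimeSpectrum Γ(Z, V)))
    have := hV.isLocalization_stalk x
    refine ⟨x, ?_⟩
    convert this
    rw [hx]
  refine exists_algebraMap_eq_of_forall_isPrincipalIdealRing (R := Γ(Z, V)) (K := Z.functionField)
    (g := g) ?_ ?_
  · intro p hp
    obtain ⟨x, hx⟩ := hloc p
    exact IsIntegrallyClosed.of_equiv
      (IsLocalization.algEquiv p.primeCompl (Z.presheaf.stalk x.1) (Localization.AtPrime p)).toRingEquiv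
  · intro p hp hpid
    obtain ⟨x, hx⟩ := hloc p
    let e := (IsLocalization.algEquiv p.primeCompl (Localization.AtPrime p)
      (Z.presheaf.stalk x.1)).toRingEquiv
    obtain ⟨c, hc⟩ := hg x (IsPrincipalIdealRing.of_surjective e.toRingHom e.surjective)
    obtain ⟨a, b, rfl⟩ := IsLocalization.exists_mk'_eq p.primeCompl c
    refine ⟨a, b, b.2, ?_⟩
    rw [← hc, IsScalarTower.algebraMap_apply Γ(Z, V) (Z.presheaf.stalk x.1) Z.functionField,
      IsScalarTower.algebraMap_apply Γ(Z, V) (Z.presheaf.stalk x.1) Z.functionField, ← map_mul,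
      IsLocalization.mk'_spec']

/-- Hartogs: on a normal integral scheme, a rational function which is regular at all points of
codimension at most one is a global section. -/
theorem exists_germToFunctionField_top_eq {Z : Scheme.{u}} [IsIntegral Z]
    [IsLocallyNoetherian Z] [∀ z : Z, IsIntegrallyClosed (Z.presheaf.stalk z)]
    {g : Z.functionField}
    (hg : ∀ z : Z, IsPrincipalIdealRing (Z.presheaf.stalk z) →
      ∃ a : Z.presheaf.stalk z, algebraMap (Z.presheaf.stalk z) Z.functionField a = g) :
    ∃ s : Γ(Z, ⊤), Z.presheaf.germ ⊤ (genericPoint Z) trivial s = g := by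
  have h (z : Z) : ∃ V : Z.Opens, IsAffineOpen V ∧ z ∈ V := by
    obtain ⟨_, ⟨V, hV, rfl⟩, hz, -⟩ :=
      Z.isBasis_affineOpens.exists_subset_of_mem_open (Set.mem_univ z) isOpen_univ
    exact ⟨V, hV, hz⟩
  choose V hV hz using h
  have (z : Z) : Nonempty (V z) := ⟨⟨z, hz z⟩⟩
  choose s hs using fun z => exists_germToFunctionField_eq_of_isAffineOpen hg (hV z)
  have hη (U : Z.Opens) (z : Z) (hz : z ∈ U) : genericPoint Z ∈ U :=
    ((genericPoint_spec Z).specializes trivial).mem_open U.2 hz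
  obtain ⟨t, ht, -⟩ := Z.sheaf.existsUnique_gluing' V ⊤ (fun z => homOfLE le_top)
    (fun z _ => Opens.mem_iSup.2 ⟨z, hz z⟩) s (fun y z => by
      have hyz : genericPoint Z ∈ V y ⊓ V z := ⟨hη _ y (hz y), hη _ z (hz z)⟩
      apply germ_injective_of_isIntegral Z (genericPoint Z) hyz
      refine (Z.presheaf.germ_res_apply _ _ hyz _).trans
        (Eq.trans ?_ (Z.presheaf.germ_res_apply _ _ hyz _).symm)
      exact (hs y).trans (hs z).symm)
  refine ⟨t, ?_⟩
  rw [← hs (genericPoint Z), ← ht (genericPoint Z)]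
  exact (Z.presheaf.germ_res_apply _ _ _ _).symm

/-- A nonzero rational function on a normal integral proper scheme over a field which is regular at
all points of codimension at most one is a unit of every local ring: it is a global section, and
the global sections form a field. -/
theorem exists_isUnit_algebraMap_eq {K : Type u} [Field K] {Z : Scheme.{u}} [IsIntegral Z]
    [IsLocallyNoetherian Z] [∀ z : Z, IsIntegrallyClosed (Z.presheaf.stalk z)]
    (f : Z ⟶ Spec (.of K)) [UniversallyClosed f] {g : Z.functionField} (h0 : g ≠ 0)
    (hg : ∀ z : Z, IsPrincipalIdealRing (Z.presheaf.stalk z) →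
      ∃ a : Z.presheaf.stalk z, algebraMap (Z.presheaf.stalk z) Z.functionField a = g) (z : Z) :
    ∃ a : Z.presheaf.stalk z, IsUnit a ∧
      algebraMap (Z.presheaf.stalk z) Z.functionField a = g := by
  obtain ⟨s, rfl⟩ := exists_germToFunctionField_top_eq hg
  have hs : s ≠ 0 := fun h => h0 (by rw [h, map_zero])
  obtain ⟨t, ht⟩ := (isField_of_universallyClosed K f).mul_inv_cancel hs
  have : Nonempty (⊤ : Z.Opens) := ⟨⟨z, trivial⟩⟩
  exact ⟨Z.presheaf.germ ⊤ z trivial s, (IsUnit.of_mul_eq_one t ht).map _,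
    Z.algebraMap_germ_eq_germToFunctionField (U := ⊤) trivial s⟩

end AlgebraicGeometry.Scheme

/-! ### Rational functions regular in codimension one on a disjoint union of integral schemes -/

/-- Being a fraction ring transports along isomorphisms of the ring and of the field. -/
theorem IsFractionRing.of_ringEquiv {R S K L : Type*} [CommRing R] [CommRing S] [CommRing K]
    [CommRing L] [Algebra R K] [Algebra S L] [IsFractionRing S L] (e : R ≃+* S) (e' : K ≃+* L)
    (h : ∀ a, e' (algebraMap R K a) = algebraMap S L (e a)) : IsFractionRing R K := by
  let _ : Algebra S K := (e'.symm.toRingHom.comp (algebraMap S L)).toAlgebra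
  have : IsFractionRing S K := IsLocalization.isLocalization_of_algEquiv (nonZeroDivisors S)
    (AlgEquiv.ofRingEquiv (f := e'.symm) fun _ => rfl)
  refine IsLocalization.of_ringEquiv_left e (MulEquivClass.map_nonZeroDivisors e) fun a => ?_
  exact e'.injective ((h a).trans (e'.apply_symm_apply _).symm)

namespace AlgebraicGeometry.Scheme
open Opposite

/-- A point whose local ring is a field has no proper generization. -/
theorem eq_of_specializes_of_isField {X : Scheme.{u}} {x y : X} (hy : IsField (X.presheaf.stalk y))
    (h : x ⤳ y) : x = y := by
  let _ := hy.toField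
  have : Subsingleton (Spec (X.presheaf.stalk y)) :=
    inferInstanceAs (Subsingleton (PrimeSpectrum (X.presheaf.stalk y)))
  obtain ⟨p, rfl⟩ : x ∈ Set.range (X.fromSpecStalk y) := by rwa [range_fromSpecStalk]
  rw [Subsingleton.elim p (IsLocalRing.closedPoint _), fromSpecStalk_closedPoint]

/-- The integral component of a scheme through a point, together with its generic point. -/
theorem exists_isIntegral_opens_ι_eq {X : Scheme.{u}} [IsNoetherian X]
    [∀ x : X, IsDomain (X.presheaf.stalk x)] (x : X) :
    ∃ (Z : X.Opens) (_ : IsIntegral Z.toScheme) (z : Z.toScheme), Z.ι z = x ∧ IsClosed (Z : Set X) ∧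
      ∀ η : X, η ⤳ x → IsField (X.presheaf.stalk η) → Z.ι (genericPoint Z) = η := by
  obtain ⟨Z, hx, hc, hZ⟩ := exists_isIntegral_opens x
  refine ⟨Z, hZ, ⟨x, hx⟩, rfl, hc, fun η h hη => eq_of_specializes_of_isField hη ?_⟩
  have hηZ : η ∈ Z := h.mem_open Z.2 hx
  exact ((genericPoint_spec Z).specializes (y := ⟨η, hηZ⟩) trivial).map Z.ι.continuous

theorem isField_stalk_ι_genericPoint {X : Scheme.{u}} (Z : X.Opens) [IsIntegral Z.toScheme] :
    IsField (X.presheaf.stalk (Z.ι (genericPoint Z))) :=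
  (asIso (Z.ι.stalkMap (genericPoint Z))).commRingCatIsoToRingEquiv.toMulEquiv.isField
    (Field.toIsField Z.toScheme.functionField)

theorem exists_specializes_isField_stalk {X : Scheme.{u}} [IsNoetherian X]
    [∀ x : X, IsDomain (X.presheaf.stalk x)] (x : X) :
    ∃ η : X, η ⤳ x ∧ IsField (X.presheaf.stalk η) := by
  obtain ⟨Z, hZ, z, rfl, -, -⟩ := exists_isIntegral_opens_ι_eq x
  exact ⟨_, ((genericPoint_spec Z).specializes trivial).map Z.ι.continuous,
    isField_stalk_ι_genericPoint Z⟩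

/-- The local ring at a generic point is the fraction field of the local rings at its
specializations. -/
theorem isFractionRing_stalk {X : Scheme.{u}} [IsNoetherian X]
    [∀ x : X, IsDomain (X.presheaf.stalk x)] {η x : X} (h : η ⤳ x)
    (hη : IsField (X.presheaf.stalk η)) :
    letI := (X.presheaf.stalkSpecializes h).hom.toAlgebra
    IsFractionRing (X.presheaf.stalk x) (X.presheaf.stalk η) := by
  obtain ⟨Z, hZ, z, rfl, -, hZη⟩ := exists_isIntegral_opens_ι_eq x
  obtain rfl := hZη η h hη
  let _ := (X.presheaf.stalkSpecializes h).hom.toAlgebra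
  let e := (asIso (Z.ι.stalkMap z)).commRingCatIsoToRingEquiv
  let e' := (asIso (Z.ι.stalkMap (genericPoint Z))).commRingCatIsoToRingEquiv
  have h1 : IsFractionRing (Z.toScheme.presheaf.stalk z) Z.toScheme.functionField := inferInstance
  have hcomm (a : X.presheaf.stalk (Z.ι z)) :
      e' (algebraMap _ (X.presheaf.stalk (Z.ι (genericPoint Z))) a) =
        algebraMap (Z.toScheme.presheaf.stalk z) Z.toScheme.functionField (e a) :=
    congr($(Z.ι.stalkSpecializes_stalkMap _ _ ((genericPoint_spec Z).specializes trivial)) a)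
  exact IsFractionRing.of_ringEquiv e e' hcomm

/-- A nonzero rational function on a normal proper scheme over a field which is regular at all
points of codimension at most one is a unit of every local ring. -/
theorem exists_isUnit_stalkSpecializes_eq {K : Type u} [Field K] {X : Scheme.{u}}
    (f : X ⟶ Spec (.of K)) [IsProper f] [∀ x : X, IsDomain (X.presheaf.stalk x)]
    [∀ x : X, IsIntegrallyClosed (X.presheaf.stalk x)] {η x : X} (h : η ⤳ x)
    (hη : IsField (X.presheaf.stalk η)) {g : X.presheaf.stalk η} (h0 : g ≠ 0)
    (hg : ∀ (y : X) (hy : η ⤳ y), IsPrincipalIdealRing (X.presheaf.stalk y) →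
      ∃ a : X.presheaf.stalk y, X.presheaf.stalkSpecializes hy a = g) :
    ∃ a : X.presheaf.stalk x, IsUnit a ∧ X.presheaf.stalkSpecializes h a = g := by
  have := isNoetherian_of_isProper f
  obtain ⟨Z, hZ, z, rfl, hcl, hZη⟩ := exists_isIntegral_opens_ι_eq x
  obtain rfl := hZη η h hη
  have := isClosedImmersion_ι hcl
  let e (z : Z.toScheme) := (asIso (Z.ι.stalkMap z)).commRingCatIsoToRingEquiv
  have (z : Z.toScheme) : IsIntegrallyClosed (Z.toScheme.presheaf.stalk z) := .of_equiv (e z)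
  have hsp (z : Z.toScheme) : genericPoint Z ⤳ z := (genericPoint_spec Z).specializes trivial
  have hcomm (z : Z.toScheme) (a : X.presheaf.stalk (Z.ι z)) :
      e _ (X.presheaf.stalkSpecializes ((hsp z).map Z.ι.continuous) a) =
        algebraMap (Z.toScheme.presheaf.stalk z) Z.toScheme.functionField (e z a) :=
    congr($(Z.ι.stalkSpecializes_stalkMap _ _ (hsp z)) a)
  obtain ⟨a, ha, hag⟩ := exists_isUnit_algebraMap_eq (Z.ι ≫ f) (g := e _ g)
    (by simpa using h0) (fun z hz => by
      obtain ⟨a, rfl⟩ := hg (Z.ι z) ((hsp z).map Z.ι.continuous)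
        (IsPrincipalIdealRing.of_surjective (e z).symm.toRingHom (e z).symm.surjective)
      exact ⟨e z a, (hcomm z a).symm⟩) z
  refine ⟨(e z).symm a, ha.map _, (e (genericPoint Z)).injective ?_⟩
  rw [← hag]
  refine (hcomm z _).trans ?_
  rw [RingEquiv.apply_symm_apply]

end AlgebraicGeometry.Scheme

/-! ### Volume forms under birational maps -/

/-- A local homomorphism of smooth local algebras which carries a volume form to a unit
multiple of a volume form has a principal ideal domain as its source if its target is one: it
carries a basis of the differentials to a basis. -/
theorem IsSmoothLocalAlgebra.isPrincipalIdealRing_of_formMap_eq {n : ℕ} {k A B : Type*} [Field k]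
    [PerfectField k] [CommRing A] [IsLocalRing A] [Algebra k A] [CommRing B] [IsLocalRing B]
    [Algebra k B] (hA : IsSmoothLocalAlgebra n k A) (hB : IsSmoothLocalAlgebra n k B)
    (φ : A →ₐ[k] B) [IsLocalHom (φ : A →+* B)] (hpid : IsPrincipalIdealRing B)
    {s : ⋀[A]^n Ω[A⁄k]} {t : ⋀[B]^n Ω[B⁄k]} (ht : Submodule.span B {t} = ⊤) {u : B}
    (hu : IsUnit u) (h : KaehlerDifferential.formMap n φ s = u • t) :
    IsPrincipalIdealRing A := by
  have := hA.formallySmooth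
  have := hA.essFiniteType
  have := hA.isNoetherianRing
  have := hA.isDomain
  obtain ⟨a⟩ := hA.nonempty_basis
  obtain ⟨b⟩ := hB.nonempty_basis
  obtain ⟨b', hb'⟩ := exteriorPower.exists_basis_of_semilinearMap_eq
    (KaehlerDifferential.semilinearMap φ) a b ht hu h
  let _ := φ.toRingHom.toAlgebra
  have : IsScalarTower k A B := .of_algebraMap_eq' φ.comp_algebraMap.symm
  have : IsLocalHom (algebraMap A B) := ‹IsLocalHom (φ : A →+* B)›
  refine ((tfae_of_isNoetherianRing_of_isLocalRing_of_isDomain A).out 0 4).2 ?_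
  exact IsLocalRing.isPrincipal_maximalIdeal_of_basis_kaehlerDifferential
    (hpid.principal _) a b' hb'

namespace AlgebraicGeometry.Scheme
open Opposite

variable {k : Type u} [Field k] {U X Y : Scheme.{u}}

/-- The map on local rings induced by a morphism of schemes over `k`. -/
noncomputable def StalkAlg.map {sX : X ⟶ Spec (.of k)} {sY : Y ⟶ Spec (.of k)} (φ : X ⟶ Y)
    (h : φ ≫ sY = sX) (x : X) : StalkAlg sY (φ x) →ₐ[k] StalkAlg sX x :=
  { (φ.stalkMap x).hom with
    commutes' := fun r => by
      have h1 := congr($(φ.germ_stalkMap ⊤ x trivial) ((structureHom sY).app (op ⊤) r))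
      refine h1.trans (congrArg (X.presheaf.germ ⊤ x trivial) ?_)
      subst h
      simp [structureHom]
      rfl }

theorem StalkAlg.specializes_map {sX : X ⟶ Spec (.of k)} {sY : Y ⟶ Spec (.of k)} (φ : X ⟶ Y)
    (h : φ ≫ sY = sX) {x y : X} (hxy : x ⤳ y) (a : StalkAlg sY (φ y)) :
    StalkAlg.specializes sX hxy (StalkAlg.map φ h y a) =
      StalkAlg.map φ h x (StalkAlg.specializes sY (hxy.map φ.continuous) a) :=
  (φ.stalkSpecializes_stalkMap_apply x y hxy a).symm

/-- The isomorphism of local rings induced by an open immersion over `k`. -/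
noncomputable def StalkAlg.mapEquiv {sX : X ⟶ Spec (.of k)} {sY : Y ⟶ Spec (.of k)} (φ : X ⟶ Y)
    (h : φ ≫ sY = sX) (x : X) [IsIso (φ.stalkMap x)] : StalkAlg sY (φ x) ≃ₐ[k] StalkAlg sX x :=
  AlgEquiv.ofBijective (StalkAlg.map φ h x)
    (ConcreteCategory.bijective_of_isIso (φ.stalkMap x))

theorem VolumeForm.smul_germ_cancel {n : ℕ} {sX : X ⟶ Spec (.of k)} [SmoothOfRelativeDimension n sX]
    (ω : VolumeForm sX n) {x : X} {a b : StalkAlg sX x} (h : a • ω.germ x = b • ω.germ x) :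
    a = b := by
  obtain ⟨e⟩ := (isSmoothLocalAlgebra_stalkAlg (n := n) sX x).nonempty_basis
  have := congrArg (exteriorPower.detForm e) h
  rw [map_smul, map_smul] at this
  exact (exteriorPower.isUnit_detForm e (ω.span_germ x)).mul_right_cancel this

set_option maxHeartbeats 1000000 in
/-- Let `φ : U ⟶ Y` be a birational morphism defined on an open subset of a proper scheme `X`, which
contains all points of codimension at most one. If `X` and `Y` carry volume forms, `φ` maps points
of codimension at most one to points of codimension at most one: the pullback of the volume form
of `Y` is the product of the volume form of `X` by a rational function, which is regular in
codimension one and hence a unit. -/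
theorem isPrincipalIdealRing_stalk_of_volumeForm [PerfectField k] {n : ℕ}
    {sX : X ⟶ Spec (.of k)} {sY : Y ⟶ Spec (.of k)} {sU : U ⟶ Spec (.of k)}
    [SmoothOfRelativeDimension n sX] [SmoothOfRelativeDimension n sY] [IsProper sX]
    (ωX : VolumeForm sX n) (ωY : VolumeForm sY n)
    (j : U ⟶ X) [IsOpenImmersion j] (hj : j ≫ sX = sU) (φ : U ⟶ Y) (hφ : φ ≫ sY = sU)
    (hU : ∀ x : X, IsPrincipalIdealRing (X.presheaf.stalk x) → x ∈ Set.range j)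
    (hgen : ∀ d : U, IsField (X.presheaf.stalk (j d)) → IsIso (φ.stalkMap d))
    (d : U) (hd : IsPrincipalIdealRing (X.presheaf.stalk (j d))) :
    IsPrincipalIdealRing (Y.presheaf.stalk (φ d)) := by
  have := isNoetherian_of_isProper sX
  have (x : X) : IsDomain (X.presheaf.stalk x) :=
    (isSmoothLocalAlgebra_stalkAlg (n := n) sX x).isDomain
  have (x : X) : IsIntegrallyClosed (X.presheaf.stalk x) :=
    (isSmoothLocalAlgebra_stalkAlg (n := n) sX x).isIntegrallyClosed
  let P (e : U) : StalkAlg sY (φ e) →ₐ[k] StalkAlg sX (j e) :=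
    (StalkAlg.mapEquiv j hj e).symm.toAlgHom.comp (StalkAlg.map φ hφ e)
  have hP {d e : U} (h : d ⤳ e) (a : StalkAlg sY (φ e)) :
      StalkAlg.specializes sX (h.map j.continuous) (P e a) =
        P d (StalkAlg.specializes sY (h.map φ.continuous) a) := by
    apply (StalkAlg.mapEquiv j hj d).injective
    refine (StalkAlg.specializes_map j hj h _).symm.trans ?_
    refine Eq.trans ?_ ((StalkAlg.mapEquiv j hj d).apply_symm_apply _).symm
    refine Eq.trans ?_ (StalkAlg.specializes_map φ hφ h a)
    exact congrArg _ ((StalkAlg.mapEquiv j hj e).apply_symm_apply _)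
  -- the quotient of the pullback of `ωY` by `ωX`
  have hc (e : U) : ∃ c : StalkAlg sX (j e),
      c • ωX.germ (j e) = KaehlerDifferential.formMap n (P e) (ωY.germ (φ e)) :=
    Submodule.mem_span_singleton.1 (ωX.span_germ (j e) ▸ trivial)
  choose c hc using hc
  have hcs {d e : U} (h : d ⤳ e) :
      StalkAlg.specializes sX (h.map j.continuous) (c e) = c d := by
    apply ωX.smul_germ_cancel
    rw [hc d, ← ωY.specializes (h.map φ.continuous),
      KaehlerDifferential.formMap_formMap n _ _
        ((P d).comp (StalkAlg.specializes sY (h.map φ.continuous))) fun _ => rfl,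
      ← KaehlerDifferential.formMap_formMap n (P e) (StalkAlg.specializes sX (h.map j.continuous))
        _ (hP h), ← hc e, map_smulₛₗ, ωX.specializes]
    rfl
  -- the rational function `c` on the component of `j d`, at the generic point `j δ`
  obtain ⟨η, hη, hηf⟩ := exists_specializes_isField_stalk (j d)
  obtain ⟨δ, rfl⟩ := hU η hηf.isPrincipalIdealRing
  have hδ : δ ⤳ d := j.isOpenEmbedding.isInducing.specializes_iff.1 hη
  have := hgen δ hηf
  -- `φ` is an isomorphism on local rings at the generic point, so the pullback of `ωY` is nonzero
  have h0 : c δ ≠ 0 := by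
    intro h0
    let P' : StalkAlg sX (j δ) →ₐ[k] StalkAlg sY (φ δ) :=
      (StalkAlg.mapEquiv φ hφ δ).symm.toAlgHom.comp (StalkAlg.map j hj δ)
    have hP' (a) : P' (P δ a) = a := by
      refine Eq.trans (congrArg (StalkAlg.mapEquiv φ hφ δ).symm ?_)
        ((StalkAlg.mapEquiv φ hφ δ).symm_apply_apply a)
      exact (StalkAlg.mapEquiv j hj δ).apply_symm_apply _
    have h1 := congrArg (KaehlerDifferential.formMap n P') (hc δ)
    rw [h0, zero_smul, map_zero, KaehlerDifferential.formMap_formMap n (P δ) P'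
      (AlgHom.id k _) hP', KaehlerDifferential.formMap_eq_self n _ fun _ => rfl] at h1
    exact zero_ne_one (ωY.smul_germ_cancel (x := φ δ) (a := 0) (b := 1) (by simp [← h1]))
  obtain ⟨a, ha, hac⟩ := exists_isUnit_stalkSpecializes_eq sX hη hηf (g := c δ) h0 (by
    intro y hy hpid
    obtain ⟨e, rfl⟩ := hU y hpid
    exact ⟨c e, hcs (j.isOpenEmbedding.isInducing.specializes_iff.1 hy)⟩)
  have hac' : a = c d := by
    let _ := (X.presheaf.stalkSpecializes hη).hom.toAlgebra
    have := isFractionRing_stalk hη hηf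
    exact IsFractionRing.injective (X.presheaf.stalk (j d)) (X.presheaf.stalk (j δ))
      (hac.trans (hcs hδ).symm)
  have : IsLocalHom (P d : StalkAlg sY (φ d) →+* StalkAlg sX (j d)) := by
    have h1 : IsLocalHom (φ.stalkMap d).hom := φ.toLRSHom.prop d
    refine ⟨fun a h => h1.map_nonunit a ?_⟩
    have h2 := h.map (StalkAlg.mapEquiv j hj d)
    exact (StalkAlg.mapEquiv j hj d).apply_symm_apply (StalkAlg.map φ hφ d a) ▸ h2
  exact (isSmoothLocalAlgebra_stalkAlg (n := n) sY (φ d)).isPrincipalIdealRing_of_formMap_eq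
    (isSmoothLocalAlgebra_stalkAlg (n := n) sX (j d)) (P d) hd (ωX.span_germ (j d))
    (hac' ▸ ha) (hc d).symm

end AlgebraicGeometry.Scheme

/-! ### Extension of rational maps in codimension one -/

namespace AlgebraicGeometry.Scheme
open Opposite

/-- Morphisms on two open subschemes which agree on the intersection glue. -/
theorem exists_hom_sup {X Y : Scheme.{u}} {U V : X.Opens} (f : U.toScheme ⟶ Y) (g : V.toScheme ⟶ Y)
    (h : X.homOfLE (inf_le_left : U ⊓ V ≤ U) ≫ f = X.homOfLE (inf_le_right : U ⊓ V ≤ V) ≫ g) :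
    ∃ F : (U ⊔ V).toScheme ⟶ Y, X.homOfLE le_sup_left ≫ F = f ∧ X.homOfLE le_sup_right ≫ F = g := by
  let W : Bool → X.Opens := fun b => match b with
    | true => U
    | false => V
  let F : ∀ b, (W b).toScheme ⟶ Y := fun b => match b with
    | true => f
    | false => g
  have hW : ∀ b, W b ≤ U ⊔ V := fun b => match b with
    | true => le_sup_left
    | false => le_sup_right
  let 𝒰 : OpenCover.{0} (U ⊔ V).toScheme :=
    { I₀ := Bool
      X := fun b => (W b).toScheme
      f := fun b => X.homOfLE (hW b)
      mem₀ := by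
        rw [presieve₀_mem_precoverage_iff]
        refine ⟨fun x ↦ ?_, inferInstance⟩
        rcases x.2 with hx | hx
        · exact ⟨true, ⟨x.1, hx⟩, Subtype.ext (by simp)⟩
        · exact ⟨false, ⟨x.1, hx⟩, Subtype.ext (by simp)⟩ }
  have hF : ∀ a b : Bool, X.homOfLE (inf_le_left : W a ⊓ W b ≤ W a) ≫ F a =
      X.homOfLE (inf_le_right : W a ⊓ W b ≤ W b) ≫ F b := by
    rintro (_ | _) (_ | _)
    · rfl
    · have h1 := congr(X.homOfLE (inf_comm V U).le ≫ $h)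
      rw [homOfLE_homOfLE_assoc, homOfLE_homOfLE_assoc] at h1
      exact h1.symm
    · exact h
    · rfl
  have hF' : ∀ a b : 𝒰.I₀, Limits.pullback.fst (𝒰.f a) (𝒰.f b) ≫ F a =
      Limits.pullback.snd (𝒰.f a) (𝒰.f b) ≫ F b := fun a b => by
    refine (cancel_epi (isPullback_opens_inf_le (hW a) (hW b)).isoPullback.hom).mp ?_
    rw [IsPullback.isoPullback_hom_fst_assoc, IsPullback.isoPullback_hom_snd_assoc]
    exact hF a b
  exact ⟨𝒰.glueMorphisms F hF', 𝒰.ι_glueMorphisms F hF' true, 𝒰.ι_glueMorphisms F hF' false⟩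

theorem Opens.fromSpecStalkOfMem_homOfLE {X : Scheme.{u}} {U V : X.Opens} (h : V ≤ U) {x : X}
    (hx : x ∈ V) : V.fromSpecStalkOfMem x hx ≫ X.homOfLE h = U.fromSpecStalkOfMem x (h hx) := by
  rw [← cancel_mono U.ι]
  simp

theorem Opens.SpecMap_stalkSpecializes_fromSpecStalkOfMem {X : Scheme.{u}} {U : X.Opens} {x y : X}
    (h : x ⤳ y) (hy : y ∈ U) :
    Spec.map (X.presheaf.stalkSpecializes h) ≫ U.fromSpecStalkOfMem y hy =
      U.fromSpecStalkOfMem x (h.mem_open U.2 hy) := by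
  rw [← cancel_mono U.ι]
  simp [SpecMap_stalkSpecializes_fromSpecStalk]

theorem Opens.fromSpecStalk_comp_eq {X Y : Scheme.{u}} {U : X.Opens} (x : U.toScheme)
    {f g : U.toScheme ⟶ Y}
    (h : U.fromSpecStalkOfMem x.1 x.2 ≫ f = U.fromSpecStalkOfMem x.1 x.2 ≫ g) :
    U.toScheme.fromSpecStalk x ≫ f = U.toScheme.fromSpecStalk x ≫ g := by
  have h1 : U.toScheme.fromSpecStalk x =
      Spec.map (U.ι.stalkMap x) ≫ U.fromSpecStalkOfMem x.1 x.2 := by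
    change _ = Spec.map (U.ι.stalkMap x) ≫ Spec.map (inv (U.ι.stalkMap x)) ≫
      U.toScheme.fromSpecStalk x
    rw [← Spec.map_comp_assoc, IsIso.inv_hom_id, Spec.map_id, Category.id_comp]
  rw [h1]
  exact congr(Spec.map (U.ι.stalkMap x) ≫ $h)

/-- A point whose local ring is a field lies in every dense open subset. -/
theorem mem_of_dense_of_isField {X : Scheme.{u}} [IsNoetherian X]
    [∀ x : X, IsDomain (X.presheaf.stalk x)] {η : X} (hη : IsField (X.presheaf.stalk η))
    {D : X.Opens} (hD : Dense (D : Set X)) : η ∈ D := by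
  obtain ⟨Z, hZ, z, hz, -, hZη⟩ := exists_isIntegral_opens_ι_eq η
  obtain ⟨y, hyZ, hyD⟩ := hD.inter_open_nonempty _ Z.2 ⟨_, z.2⟩
  rw [← hZη η specializes_rfl hη]
  exact (((genericPoint_spec Z).specializes (y := ⟨y, hyZ⟩) trivial).map Z.ι.continuous).mem_open
    D.2 hyD

/-- The valuative criterion for the local ring at a point of codimension at most one. -/
theorem exists_SpecMap_stalkSpecializes_comp_eq {S X Y : Scheme.{u}} {sX : X ⟶ S}
    {sY : Y ⟶ S} [UniversallyClosed sY] [IsNoetherian X] [∀ x : X, IsDomain (X.presheaf.stalk x)]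
    {x η : X} (hηx : η ⤳ x) (hη : IsField (X.presheaf.stalk η))
    (hx : IsPrincipalIdealRing (X.presheaf.stalk x)) (g : Spec (X.presheaf.stalk η) ⟶ Y)
    (hg : g ≫ sY = X.fromSpecStalk η ≫ sX) :
    ∃ l : Spec (X.presheaf.stalk x) ⟶ Y,
      Spec.map (X.presheaf.stalkSpecializes hηx) ≫ l = g ∧ l ≫ sY = X.fromSpecStalk x ≫ sX := by
  let _ := (X.presheaf.stalkSpecializes hηx).hom.toAlgebra
  have hfr := isFractionRing_stalk hηx hη
  let _ := hη.toField
  let Q : ValuativeCommSq sY :=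
    { R := X.presheaf.stalk x
      K := X.presheaf.stalk η
      isFractionRing := hfr
      i₁ := g
      i₂ := X.fromSpecStalk x ≫ sX
      commSq := ⟨hg.trans (SpecMap_stalkSpecializes_fromSpecStalk_assoc hηx sX).symm⟩ }
  have hQ : Q.commSq.HasLift := by
    have : UniversallyClosed sY := inferInstance
    rw [UniversallyClosed.eq_valuativeCriterion] at this
    exact this.1 Q
  exact ⟨Q.commSq.lift, Q.commSq.fac_left, Q.commSq.fac_right⟩

/-- A rational map to a proper scheme is defined at the points whose local ring is a principal ideal
domain. -/
theorem mem_domain_toRationalMap_of_isPrincipalIdealRing {S X Y : Scheme.{u}} {sX : X ⟶ S}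
    {sY : Y ⟶ S} [IsProper sY] [IsNoetherian X] [∀ x : X, IsDomain (X.presheaf.stalk x)]
    (φ : X.PartialMap Y) (hφ : φ.hom ≫ sY = φ.domain.ι ≫ sX) {x : X}
    (hx : IsPrincipalIdealRing (X.presheaf.stalk x)) : x ∈ φ.toRationalMap.domain := by
  obtain ⟨η, hηx, hη⟩ := exists_specializes_isField_stalk x
  have hηD : η ∈ φ.domain := mem_of_dense_of_isField hη φ.dense_domain
  -- by the valuative criterion, `φ` extends to the spectrum of the local ring at `x`
  obtain ⟨l, hl, hls⟩ := exists_SpecMap_stalkSpecializes_comp_eq (sX := sX) (sY := sY) hηx hη hx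
    (φ.domain.fromSpecStalkOfMem η hηD ≫ φ.hom)
    (by rw [Category.assoc, hφ, Opens.fromSpecStalkOfMem_ι_assoc])
  -- spread out to an open neighbourhood of `x`, which can be taken in a component of `X`
  obtain ⟨U, hxU, F, hF, hFs⟩ := spread_out_of_isGermInjective' sX sY l hls
  obtain ⟨Z, hxZ, -, hZ⟩ := exists_isIntegral_opens x
  let U' := U ⊓ Z
  have hηU' : η ∈ U' := hηx.mem_open U'.2 ⟨hxU, hxZ⟩
  let W : X.Opens := U' ⊓ φ.domain
  have hηW : η ∈ W := ⟨hηU', hηD⟩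
  -- both morphisms agree near the generic point `η`, hence on the irreducible open subset `W`
  have hagree : X.homOfLE (inf_le_left : W ≤ U') ≫ X.homOfLE (inf_le_left : U' ≤ U) ≫ F =
      X.homOfLE (inf_le_right : W ≤ φ.domain) ≫ φ.hom := by
    have : W.toScheme.IsGermInjectiveAt ⟨η, hηW⟩ :=
      (isGermInjectiveAt_iff_of_isOpenImmersion (f := W.ι)).1 inferInstance
    obtain ⟨N, hN, hNe⟩ := spread_out_unique_of_isGermInjective' (x := (⟨η, hηW⟩ : W.toScheme))
      (X.homOfLE (inf_le_left : W ≤ U') ≫ X.homOfLE (inf_le_left : U' ≤ U) ≫ F)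
      (X.homOfLE (inf_le_right : W ≤ φ.domain) ≫ φ.hom) (Opens.fromSpecStalk_comp_eq _ (by
        rw [← Category.assoc, ← Category.assoc, ← Category.assoc,
          Opens.fromSpecStalkOfMem_homOfLE, Opens.fromSpecStalkOfMem_homOfLE,
          Opens.fromSpecStalkOfMem_homOfLE, ← hl, hF,
          ← Opens.SpecMap_stalkSpecializes_fromSpecStalkOfMem hηx hxU, Category.assoc]))
    have : IsReduced X := by
      have (y : X) : _root_.IsReduced (X.presheaf.stalk y) := inferInstance
      exact isReduced_of_isReduced_stalk X
    have : PreirreducibleSpace (Z : Set X) :=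
      inferInstanceAs (PreirreducibleSpace Z.toScheme)
    have : PreirreducibleSpace W := Subtype.preirreducibleSpace <|
      IsPreirreducible.open_subset (IsPreirreducible.of_subtype (s := (Z : Set X))) W.2
        fun _ h => h.1.2
    have : IsDominant N.ι := Opens.isDominant_ι (N.2.dense ⟨_, hN⟩)
    exact ext_of_isDominant_of_isSeparated sY (by simp [hφ, hFs]) N.ι hNe
  obtain ⟨G, -, hG⟩ := exists_hom_sup (X.homOfLE (inf_le_left : U' ≤ U) ≫ F) φ.hom hagree
  refine RationalMap.mem_domain.2
    ⟨⟨U' ⊔ φ.domain, φ.dense_domain.mono le_sup_right, G⟩, Or.inl ⟨hxU, hxZ⟩, ?_⟩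
  refine PartialMap.toRationalMap_eq_iff.2
    ⟨φ.domain, φ.dense_domain, le_sup_right, le_rfl, ?_⟩
  change X.homOfLE _ ≫ G = X.homOfLE _ ≫ φ.hom
  rw [hG, homOfLE_rfl, Category.id_comp]

end AlgebraicGeometry.Scheme

/-! ### Isomorphism in codimension one -/

namespace AlgebraicGeometry.Scheme

theorem isSeparated_of_isSeparated_Spec {R : CommRingCat.{u}} {X : Scheme.{u}} (f : X ⟶ Spec R)
    [IsSeparated f] : X.IsSeparated := by
  rw [isSeparated_iff, ← Limits.terminal.comp_from f]
  infer_instance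

/-- A normal Noetherian local domain of dimension at most one is principal. -/
theorem isPrincipalIdealRing_stalk_of_coheight_le {X : Scheme.{u}} {x : X}
    (hn : IsNoetherianRing (X.presheaf.stalk x)) (hd : IsDomain (X.presheaf.stalk x))
    (hi : IsIntegrallyClosed (X.presheaf.stalk x)) (hx : Order.coheight x ≤ 1) :
    IsPrincipalIdealRing (X.presheaf.stalk x) := by
  have : Ring.KrullDimLE 1 (X.presheaf.stalk x) := krullDimLE_of_coheight_le (n := 1) (by simpa)
  refine ((tfae_of_isNoetherianRing_of_isLocalRing_of_isDomain
    (X.presheaf.stalk x)).out 0 3).2 ?_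
  refine ⟨hi, fun P hP _ => ?_⟩
  exact IsLocalRing.eq_maximalIdeal (Ideal.isMaximal_of_isPrime_of_ne_bot P hP)

variable {X Y : Scheme.{u}}

/-- The open subset of `X` on which the partial map `f` takes values in the domain of `g`. -/
noncomputable def PartialMap.domainComp (f : X.PartialMap Y) (g : Y.PartialMap X) : X.Opens :=
  f.domain.ι ''ᵁ (f.hom ⁻¹ᵁ g.domain)

theorem PartialMap.domainComp_le (f : X.PartialMap Y) (g : Y.PartialMap X) :
    f.domainComp g ≤ f.domain :=
  (Set.image_subset_range _ _).trans_eq Subtype.range_val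

theorem PartialMap.mem_domainComp {f : X.PartialMap Y} {g : Y.PartialMap X} {d : f.domain.toScheme} :
    f.domain.ι d ∈ f.domainComp g ↔ f.hom d ∈ g.domain :=
  ⟨fun ⟨_, he, hed⟩ => f.domain.ι.isOpenEmbedding.injective hed ▸ he, fun h => ⟨d, h, rfl⟩⟩

/-- Let `f` and `g` be partial maps which extend a birational isomorphism `φ` and its inverse. Then
`g ∘ f` is the inclusion on its domain of definition `f.domainComp g`. -/
theorem PartialMap.exists_comp_hom_eq_ι [IsReduced X] [X.IsSeparated]
    (φ : X.PartialIso Y) (f : X.PartialMap Y) (g : Y.PartialMap X)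
    (hfs : φ.source ≤ f.domain) (hgs : φ.target ≤ g.domain)
    (hf : X.homOfLE hfs ≫ f.hom = φ.iso.hom ≫ φ.target.ι)
    (hg : Y.homOfLE hgs ≫ g.hom = φ.iso.inv ≫ φ.source.ι) :
    φ.source ≤ f.domainComp g ∧ ∃ h : (f.domainComp g).toScheme ⟶ g.domain.toScheme,
      h ≫ g.domain.ι = X.homOfLE (f.domainComp_le g) ≫ f.hom ∧ h ≫ g.hom = (f.domainComp g).ι := by
  have hs : φ.source ≤ f.domainComp g := fun x hx => by
    let x' : φ.source.toScheme := ⟨x, hx⟩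
    have h1 : f.hom (X.homOfLE hfs x') ∈ g.domain := by
      have := congr($hf x')
      simp only [Hom.comp_apply] at this
      rw [this]
      exact hgs (φ.iso.hom x').2
    have h2 := mem_domainComp.2 h1
    rwa [← Hom.comp_apply, homOfLE_ι] at h2
  have hrange : Set.range (X.homOfLE (f.domainComp_le g) ≫ f.hom) ⊆ Set.range g.domain.ι := by
    rintro _ ⟨x, rfl⟩
    rw [Opens.range_ι, Hom.comp_apply]
    refine mem_domainComp.1 ?_
    rw [← Hom.comp_apply, homOfLE_ι]
    exact x.2
  refine ⟨hs, IsOpenImmersion.lift g.domain.ι _ hrange, IsOpenImmersion.lift_fac _ _ _, ?_⟩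
  have := Opens.isDominant_homOfLE φ.dense_source hs
  refine ext_of_isDominant (X.homOfLE hs) ?_
  have h1 : X.homOfLE hs ≫ IsOpenImmersion.lift g.domain.ι _ hrange =
      φ.iso.hom ≫ Y.homOfLE hgs := by
    rw [← cancel_mono g.domain.ι, Category.assoc, IsOpenImmersion.lift_fac, homOfLE_homOfLE_assoc,
      hf, Category.assoc, homOfLE_ι]
  rw [reassoc_of% h1, hg, Iso.hom_inv_id_assoc, homOfLE_ι]

/-- Partial maps which extend a birational isomorphism and its inverse restrict to an isomorphism
of the open subsets on which the compositions are defined. -/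
theorem PartialMap.exists_iso_domainComp [IsReduced X] [X.IsSeparated] [IsReduced Y]
    [Y.IsSeparated] (φ : X.PartialIso Y) (f : X.PartialMap Y) (g : Y.PartialMap X)
    (hfs : φ.source ≤ f.domain) (hgs : φ.target ≤ g.domain)
    (hf : X.homOfLE hfs ≫ f.hom = φ.iso.hom ≫ φ.target.ι)
    (hg : Y.homOfLE hgs ≫ g.hom = φ.iso.inv ≫ φ.source.ι) :
    Dense (f.domainComp g : Set X) ∧
      ∃ e : (f.domainComp g).toScheme ≅ (g.domainComp f).toScheme,
        e.hom ≫ (g.domainComp f).ι = X.homOfLE (f.domainComp_le g) ≫ f.hom := by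
  obtain ⟨hs, a, ha, ha'⟩ := exists_comp_hom_eq_ι φ f g hfs hgs hf hg
  obtain ⟨-, b, hb, hb'⟩ := exists_comp_hom_eq_ι φ.symm g f hgs hfs hg hf
  -- a morphism to the domain of `g` whose composition with `g` factors through the domain of `f`
  -- factors through `g.domainComp f`
  have key {X Y : Scheme.{u}} (f : X.PartialMap Y) (g : Y.PartialMap X)
      (a : (f.domainComp g).toScheme ⟶ g.domain.toScheme) (ha' : a ≫ g.hom = (f.domainComp g).ι) :
      ∃ a' : (f.domainComp g).toScheme ⟶ (g.domainComp f).toScheme,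
        a' ≫ Y.homOfLE (g.domainComp_le f) = a := by
    have hr : Set.range (a ≫ g.domain.ι) ⊆ Set.range (g.domainComp f).ι := by
      rintro _ ⟨x, rfl⟩
      rw [Opens.range_ι, Hom.comp_apply]
      refine mem_domainComp.2 ?_
      rw [← Hom.comp_apply, ha']
      exact f.domainComp_le g x.2
    refine ⟨IsOpenImmersion.lift (g.domainComp f).ι _ hr, ?_⟩
    rw [← cancel_mono g.domain.ι, Category.assoc, homOfLE_ι, IsOpenImmersion.lift_fac]
  obtain ⟨a', rfl⟩ := key f g a ha'
  obtain ⟨b', rfl⟩ := key g f b hb'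
  rw [Category.assoc, homOfLE_ι] at ha hb
  refine ⟨φ.dense_source.mono hs, ⟨a', b', ?_, ?_⟩, ha⟩
  · rw [← cancel_mono (f.domainComp g).ι, Category.assoc, hb, Category.id_comp, ← ha',
      Category.assoc]
  · rw [← cancel_mono (g.domainComp f).ι, Category.assoc, ha, Category.id_comp, ← hb',
      Category.assoc]

theorem PartialMap.isIso_stalkMap_of_partialIso (φ : X.PartialIso Y) (f : X.PartialMap Y)
    (hfs : φ.source ≤ f.domain) (hf : X.homOfLE hfs ≫ f.hom = φ.iso.hom ≫ φ.target.ι)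
    {d : f.domain.toScheme} (hd : f.domain.ι d ∈ φ.source) : IsIso (f.hom.stalkMap d) := by
  have hι (s : φ.source.toScheme) : f.domain.ι (X.homOfLE hfs s) = φ.source.ι s := by
    rw [← Hom.comp_apply, homOfLE_ι]
  obtain ⟨s, rfl⟩ : ∃ s, X.homOfLE hfs s = d :=
    ⟨⟨_, hd⟩, f.domain.ι.isOpenEmbedding.injective (hι _)⟩
  have h : ∀ (g : φ.source.toScheme ⟶ Y) [IsOpenImmersion g], IsIso (g.stalkMap s) :=
    fun g _ => inferInstance
  have : IsOpenImmersion (X.homOfLE hfs ≫ f.hom) := by rw [hf]; infer_instance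
  have : IsIso (f.hom.stalkMap (X.homOfLE hfs s) ≫ (X.homOfLE hfs).stalkMap s) := by
    rw [← Hom.stalkMap_comp]; exact h _
  exact IsIso.of_isIso_comp_right _ ((X.homOfLE hfs).stalkMap s)

theorem isReduced_of_smoothOfRelativeDimension {k : Type u} [Field k] (n : ℕ) (sX : X ⟶ Spec (.of k))
    [SmoothOfRelativeDimension n sX] : IsReduced X := by
  have (x : X) : _root_.IsReduced (X.presheaf.stalk x) :=
    have : IsDomain (X.presheaf.stalk x) :=
      (isSmoothLocalAlgebra_stalkAlg (n := n) sX x).isDomain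
    inferInstance
  exact isReduced_of_isReduced_stalk X

/-- If the partial maps `f` and `g` are defined at all points of codimension at most one and map
them to points of codimension at most one, the complement of the domain of definition of `g ∘ f` has
codimension at least two. -/
theorem two_le_codim_compl_domainComp {k : Type u} [Field k] {f : X.PartialMap Y} {g : Y.PartialMap X}
    (hf : ∀ x : X, IsPrincipalIdealRing (X.presheaf.stalk x) → ∃ d : f.domain.toScheme,
        f.domain.ι d = x ∧ IsPrincipalIdealRing (Y.presheaf.stalk (f.hom d)))
    (hg : ∀ y : Y, IsPrincipalIdealRing (Y.presheaf.stalk y) → ∃ d : g.domain.toScheme,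
        g.domain.ι d = y ∧ IsPrincipalIdealRing (X.presheaf.stalk (g.hom d)))
    (n : ℕ) (sX : X ⟶ Spec (.of k)) [SmoothOfRelativeDimension n sX] :
    2 ≤ codim ((f.domainComp g : Set X)ᶜ) := by
  refine le_iInf₂ fun x hx => ?_
  by_contra hlt
  have hA := isSmoothLocalAlgebra_stalkAlg (n := n) sX x
  have hx1 : Order.coheight x ≤ 1 := Order.le_of_lt_add_one (not_le.1 hlt)
  obtain ⟨d, rfl, hd⟩ := hf x (isPrincipalIdealRing_stalk_of_coheight_le hA.isNoetherianRing
    hA.isDomain hA.isIntegrallyClosed hx1)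
  obtain ⟨e, he, -⟩ := hg _ hd
  exact hx (PartialMap.mem_domainComp.2 (he ▸ e.2))

variable {k : Type u} [Field k] [PerfectField k] {n : ℕ} {sX : X ⟶ Spec (.of k)}
  {sY : Y ⟶ Spec (.of k)} [SmoothOfRelativeDimension n sX] [SmoothOfRelativeDimension n sY]
  [IsProper sX] [IsProper sY]

/-- The maximal extension of a birational map is defined at the points of codimension at most one
and maps them to points of codimension at most one. -/
theorem PartialIso.exists_partialMap (ωX : VolumeForm sX n) (ωY : VolumeForm sY n)
    (φ : X.PartialIso Y) (hφ : φ.IsOver sX sY) :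
    ∃ (f : X.PartialMap Y) (hfs : φ.source ≤ f.domain),
      X.homOfLE hfs ≫ f.hom = φ.iso.hom ≫ φ.target.ι ∧ f.hom ≫ sY = f.domain.ι ≫ sX ∧
      ∀ x : X, IsPrincipalIdealRing (X.presheaf.stalk x) → ∃ d : f.domain.toScheme,
        f.domain.ι d = x ∧ IsPrincipalIdealRing (Y.presheaf.stalk (f.hom d)) := by
  have := isReduced_of_smoothOfRelativeDimension n sX
  have := isSeparated_of_isSeparated_Spec sY
  have := isNoetherian_of_isProper sX
  have (x : X) : IsDomain (X.presheaf.stalk x) :=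
    (isSmoothLocalAlgebra_stalkAlg (n := n) sX x).isDomain
  let f := φ.toRationalMap.toPartialMap
  have hfs : φ.source ≤ f.domain := φ.toPartialMap.le_domain_toRationalMap
  have hf : X.homOfLE hfs ≫ f.hom = φ.iso.hom ≫ φ.target.ι :=
    φ.toPartialMap.toPartialMap_toRationalMap_restrict
  have hover : f.hom ≫ sY = f.domain.ι ≫ sX := by
    have := Opens.isDominant_homOfLE φ.dense_source hfs
    refine ext_of_isDominant (X.homOfLE hfs) ?_
    rw [reassoc_of% hf, hφ, homOfLE_ι_assoc]
  have hdom (x : X) (hx : IsPrincipalIdealRing (X.presheaf.stalk x)) : x ∈ Set.range f.domain.ι := by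
    rw [Opens.range_ι]
    refine mem_domain_toRationalMap_of_isPrincipalIdealRing (sX := sX) (sY := sY) φ.toPartialMap
      ((Category.assoc _ _ _).trans hφ) hx
  refine ⟨f, hfs, hf, hover, fun x hx => ?_⟩
  obtain ⟨d, rfl⟩ := hdom x hx
  refine ⟨d, rfl, isPrincipalIdealRing_stalk_of_volumeForm ωX ωY f.domain.ι rfl f.hom hover hdom
    (fun e he => f.isIso_stalkMap_of_partialIso φ hfs hf (mem_of_dense_of_isField he φ.dense_source))
    d hx⟩

/-- A birational map between smooth proper schemes with volume forms is an isomorphism in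
codimension one. -/
theorem exists_iso_of_volumeForm (ωX : VolumeForm sX n) (ωY : VolumeForm sY n)
    (hXY : BirationalOver sX sY) :
    ∃ (U : X.Opens) (V : Y.Opens), Dense (U : Set X) ∧ Dense (V : Set Y) ∧
      2 ≤ codim ((U : Set X)ᶜ) ∧ 2 ≤ codim ((V : Set Y)ᶜ) ∧
      ∃ e : U.toScheme ≅ V.toScheme, e.hom ≫ V.ι ≫ sY = U.ι ≫ sX := by
  have := isReduced_of_smoothOfRelativeDimension n sX
  have := isReduced_of_smoothOfRelativeDimension n sY
  have := isSeparated_of_isSeparated_Spec sX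
  have := isSeparated_of_isSeparated_Spec sY
  obtain ⟨φ, hφ⟩ := hXY
  obtain ⟨f, hfs, hf, hfo, hfp⟩ := φ.exists_partialMap ωX ωY hφ
  obtain ⟨g, hgs, hg, -, hgp⟩ := φ.symm.exists_partialMap ωY ωX hφ.symm
  obtain ⟨hU, e, he⟩ := PartialMap.exists_iso_domainComp φ f g hfs hgs hf hg
  obtain ⟨hV, -⟩ := PartialMap.exists_iso_domainComp φ.symm g f hgs hfs hg hf
  refine ⟨f.domainComp g, g.domainComp f, hU, hV, two_le_codim_compl_domainComp hfp hgp n sX,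
    two_le_codim_compl_domainComp hgp hfp n sY, e, ?_⟩
  rw [reassoc_of% he, hfo, homOfLE_ι_assoc]

end AlgebraicGeometry.Scheme

theorem mainTheorem2 (n : ℕ) (X Y : Scheme.{0})
    (sX : X ⟶ Spec (CommRingCat.of ℂ)) (sY : Y ⟶ Spec (CommRingCat.of ℂ))
    [SmoothOfRelativeDimension n sX] [SmoothOfRelativeDimension n sY]
    (hX : Scheme.IsProjectiveOver sX) (hY : Scheme.IsProjectiveOver sY)
    (hωX : Scheme.HasTrivialCanonicalBundle sX n) (hωY : Scheme.HasTrivialCanonicalBundle sY n)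
    (hXY : Scheme.BirationalOver sX sY) :
    ∃ (U : X.Opens) (V : Y.Opens),
      Dense (U : Set X) ∧ Dense (V : Set Y) ∧
      2 ≤ Scheme.codim ((U : Set X)ᶜ) ∧ 2 ≤ Scheme.codim ((V : Set Y)ᶜ) ∧
      ∃ e : U.toScheme ≅ V.toScheme, e.hom ≫ V.ι ≫ sY = U.ι ≫ sX := by
  have := hX.isProper
  have := hY.isProper
  obtain ⟨ωX⟩ := hωX.nonempty_volumeForm
  obtain ⟨ωY⟩ := hωY.nonempty_volumeForm
  exact Scheme.exists_iso_of_volumeForm ωX ωY hXY
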